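/- **Setting.** Let $d\ge 0$, $\hbar>0$, $\gamma\in\mathbb R$. The measured system $S$ has Hilbert space $L^2(X,\mu)$, with $\mu$ $\sigma$-finite, in a representation in which the (commuting, self-adjoint) components of the measurand $\hat Q_S=(\hat Q_{S,1},\dots,\hat Q_{S,d})$ are multiplication by the components of a measurable $q:X\to\mathbb R^d$. (For a particle, $X=\mathbb R^d$ with Lebesgue measure and $q(x)=x$; for a measurand with discrete spectrum, $\mu$ has atoms.) The apparatus $M$ has Hilbert space $L^2(\mathbb R^d)$ and momentum $\hat P_{M,j}=-i\hbar\,\partial_j$. The joint Hilbert space is $\mathcal H=L^2(X\times\mathbb R^d)$, with $(u\otimes v)(x,y)=u(x)v(y)$. The impulsive interaction is $\hat H=\gamma\,\hat Q_S\cdot\hat P_M=\gamma\sum_j\hat Q_{S,j}\otimes\hat P_{M,j}$ on the span of the vectors $u\otimes f$ with $u\in\bigcap_j\mathrm{dom}(\hat Q_{S,j})$ and $f$ a Schwartz function. Fix a sign $\sigma\in\{1,-1\}$ and let $\hat U(t)=\exp(\sigma i\hat Ht/\hbar)$, i.e. $\hat U$ is a strongly continuous one-parameter unitary group with $\frac{d}{dt}\hat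 U(t)\Phi|_{t=0}=\frac{\sigma i}{\hbar}\hat H\Phi$ on that domain. Let $\mathcal A$ be an O*-algebra of operators on a dense domain $\mathcal D\subset\mathcal H$. Its smooth states are the density operators $\rho$ with $\rho\mathcal H\subset\mathcal D$ and $\hat A\rho$ trace class for all $\hat A\in\mathcal A$. For $\delta>0$ let $\nu(\rho_1,\delta)$ be the set of smooth states $\rho$ with $\mathrm{Tr}|\rho-\rho_1|<\delta$, and let $\mathcal N(\rho_0,\hat A,\delta)$ be the set of smooth states $\rho$ with $|\mathrm{Tr}\,\rho\hat A-\mathrm{Tr}\,\rho_0\hat A|<\delta$. A set $W$ of smooth states evolves from $t_1$ to $t_2$ to $W'$ if $W'=\hat U(t_2-t_1)\,W\,\hat U(t_2-t_1)^*$. Let $\hat P_\Psi$ be the projection onto the line of a unit vector $\Psi$, and put $s=\sigma\gamma(t_2-t_1)$. Assume that $\hat U$ acts on the smooth states: $\hat U(t)\rho\hat U(t)^*$ is a smooth state for every $t$ and every smooth state $\rho$. (This assumption is used only for the claims about $\nu$ and $\mathcal N$.) **Theorem.** 1. The group $\hat U$ exists and is unique, and $(\hat U(t)\Phi)(x,y)=\Phi(x,y+\sigma\gamma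 t\,q(x))$ for all $\Phi\in\mathcal H$, $t\in\mathbb R$, and almost all $(x,y)$. 2. For every unit vector $\Psi_1\in\mathcal D$, all $t_1,t_2\in\mathbb R$ and $\delta>0$, put $\Psi_2=\hat U(t_2-t_1)\Psi_1$. Then $\nu(\hat P_{\Psi_1},\delta)$ evolves to $\nu(\hat P_{\Psi_2},\delta)$. For each $j$ such that $\hat Q_{S,j}\otimes\hat I$ belongs to $\mathcal A$, $\mathcal N(\hat P_{\Psi_1},\hat Q_{S,j},\delta)$ evolves to $\mathcal N(\hat P_{\Psi_2},\hat Q_{S,j},\delta)$. 3. Let $\psi_S^\pm$ be orthonormal eigenvectors of $\hat Q_S$ with eigenvalues $\lambda_\pm\in\mathbb R^d$, let $\phi_M$ be a unit vector, $|\alpha|^2+|\beta|^2=1$, and $\Psi(t_1)=(\alpha\psi_S^++\beta\psi_S^-)\otimes\phi_M$. Then there are unit vectors $\phi_M^\pm$ with $$\phi_M^\pm(y)=\int|\psi_S^\pm(x)|^2\,\phi_M(y+s\,q(x))\,d\mu(x)=\phi_M(y+s\lambda_\pm)\quad\text{for almost all }y,$$ such that $\hat U(t_2-t_1)\Psi(t_1)=\Psi(t_2):=\alpha\,\psi_S^+\otimes\phi_M^++\beta\,\psi_S^-\otimes\phi_M^-$.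 If $\alpha,\beta,\gamma\ne0$, $t_1\ne t_2$ and $\lambda_+\neq\lambda_-$, then $\Psi(t_2)$ is entangled, i.e. not of the form $u\otimes v$. If moreover $\Psi(t_1)\in\mathcal D$ (with no condition on $\alpha,\beta,\gamma,t_1,t_2,\lambda_\pm$ beyond those of the first sentence), then for all $\delta>0$ the condition $\nu(\hat P_{\Psi(t_1)},\delta)$ evolves to $\nu(\hat P_{\Psi(t_2)},\delta)$. For each $j$ such that $\hat Q_{S,j}\otimes\hat I$ belongs to $\mathcal A$, $\mathcal N(\hat P_{\Psi(t_1)},\hat Q_{S,j},\delta)$ evolves to $\mathcal N(\hat P_{\Psi(t_2)},\hat Q_{S,j},\delta)$. 4. (Approximate eigenvectors.) For all $t_1,t_2$, every unit vector $\phi_M$ and every $\eta>0$ there is $r>0$ such that the following holds. Let $\psi_S^\pm$ be orthonormal and $\lambda_\pm\in\mathbb R^d$ with $|q-\lambda_\pm|\le r$ almost everywhere on $\{\psi_S^\pm\ne0\}$, and let $|\alpha|^2+|\beta|^2=1$. Then there are $\phi_M^\pm\in L^2(\mathbb R^d)$ with $\phi_M^\pm(y)=\int|\psi_S^\pm(x)|^2\phi_M(y+s\,q(x))\,d\mu(x)$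 for almost all $y$ and $$\big\|\hat U(t_2-t_1)\big((\alpha\psi_S^++\beta\psi_S^-)\otimes\phi_M\big)-\big(\alpha\,\psi_S^+\otimes\phi_M^++\beta\,\psi_S^-\otimes\phi_M^-\big)\big\|\le\eta .$$ 5. For two particles ($X=\mathbb R^d$ with Lebesgue measure, $q(x)=x$), if $\mathcal A$ is the algebra generated by the positions and momenta of both particles on the Schwartz space of $\mathbb R^d\times\mathbb R^d$, then $\hat U$ acts on the smooth states of $\mathcal A$. -/

import Mathlib

open MeasureTheory
open scoped InnerProductSpace ENNReal SchwartzMap LineDeriv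

noncomputable section

namespace QRNumber

section Trace

variable {H : Type*} [NormedAddCommGroup H] [InnerProductSpace ℂ H] [CompleteSpace H]

/-- A Hilbert basis of `H`, used to evaluate traces. -/
def basisVec (H : Type*) [NormedAddCommGroup H] [InnerProductSpace ℂ H] [CompleteSpace H] :
    HilbertBasis (Classical.choose (exists_hilbertBasis ℂ H) : Set H) ℂ H :=
  Classical.choose (Classical.choose_spec (exists_hilbertBasis ℂ H))

/-- The trace norm `Tr |T|`, where `|T| = (T* T)^(1/2)`; it is `∞` if `T` is not trace class. -/
def traceNorm (T : H →L[ℂ] H) : ℝ≥0∞ :=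
  ∑' i, ENNReal.ofReal (⟪basisVec H i, CFC.abs T (basisVec H i)⟫_ℂ).re

def IsTraceClass (T : H →L[ℂ] H) : Prop := traceNorm T < ∞

/-- The trace of a trace class operator. -/
def trace (T : H →L[ℂ] H) : ℂ := ∑' i, ⟪basisVec H i, T (basisVec H i)⟫_ℂ

/-- The projection onto the line spanned by a unit vector `Ψ`. -/
def proj (Ψ : H) : H →L[ℂ] H := InnerProductSpace.rankOne ℂ Ψ Ψ

/-- An O*-algebra: a unital algebra of (in general unbounded) operators which map a common dense
domain into itself, closed under taking the formal adjoint on that domain. -/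
structure OStarAlgebra (H : Type*) [NormedAddCommGroup H] [InnerProductSpace ℂ H] where
  domain : Submodule ℂ H
  dense_domain : Dense (domain : Set H)
  alg : Subalgebra ℂ (Module.End ℂ domain)
  exists_adjoint : ∀ A ∈ alg, ∃ B ∈ alg, ∀ x y : domain,
    ⟪(A x : H), (y : H)⟫_ℂ = ⟪(x : H), (B y : H)⟫_ℂ

/-- The O*-algebra on `H` obtained from an algebra of operators on a space `V` which is embedded
in `H` as a dense subspace by `ι`. -/
def OStarAlgebra.ofInjective {V : Type*} [AddCommGroup V] [Module ℂ V] (ι : V →ₗ[ℂ] H)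
    (hι : Function.Injective ι) (hd : DenseRange ι) (S : Subalgebra ℂ (Module.End ℂ V))
    (hS : ∀ A ∈ S, ∃ B ∈ S, ∀ f g, ⟪ι (A f), ι g⟫_ℂ = ⟪ι f, ι (B g)⟫_ℂ) : OStarAlgebra H where
  domain := LinearMap.range ι
  dense_domain := hd
  alg := S.map ((LinearEquiv.ofInjective ι hι).conjAlgEquiv ℂ).toAlgHom
  exists_adjoint := by
    rintro _ ⟨A, hA, rfl⟩
    obtain ⟨B, hB, e⟩ := hS A hA
    refine ⟨_, ⟨B, hB, rfl⟩, fun x y => ?_⟩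
    have hx : ι ((LinearEquiv.ofInjective ι hι).symm x) = x :=
      congrArg Subtype.val ((LinearEquiv.ofInjective ι hι).apply_symm_apply x)
    have hy : ι ((LinearEquiv.ofInjective ι hι).symm y) = y :=
      congrArg Subtype.val ((LinearEquiv.ofInjective ι hι).apply_symm_apply y)
    have h := e ((LinearEquiv.ofInjective ι hι).symm x) ((LinearEquiv.ofInjective ι hι).symm y)
    rw [hx, hy] at h
    exact h

/-- The smooth states: density operators `ρ` with range in the common domain such that `A ρ` is
trace class for all `A` in the algebra. They are the density operators that
define (normalised, strongly positive) trace functionals `A ↦ Tr (A ρ)` on the algebra. -/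
structure OStarAlgebra.IsState (𝒜 : OStarAlgebra H) (ρ : H →L[ℂ] H) : Prop where
  pos : ρ.IsPositive
  traceClass : IsTraceClass ρ
  trace_eq_one : trace ρ = 1
  mem_domain : ∀ x, ρ x ∈ 𝒜.domain
  traceClass_mul : ∀ A ∈ 𝒜.alg, ∃ T : H →L[ℂ] H,
    (∀ x, T x = (A ⟨ρ x, mem_domain x⟩ : H)) ∧ IsTraceClass T

open Classical in
/-- The expectation value `Tr (ρ A) = Tr (A ρ)`, meaningful if `ρ` is a smooth state. -/
def expect {D : Submodule ℂ H} (A : Module.End ℂ D) (ρ : H →L[ℂ] H) : ℂ :=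
  ∑' i, ⟪basisVec H i,
    if h : ρ (basisVec H i) ∈ D then (A ⟨ρ (basisVec H i), h⟩ : H) else 0⟫_ℂ

/-- The basic condition `ν(ρ₁; δ) = {ρ : Tr |ρ - ρ₁| < δ}` in the smooth state space. -/
def nu (𝒜 : OStarAlgebra H) (ρ₁ : H →L[ℂ] H) (δ : ℝ) : Set (H →L[ℂ] H) :=
  {ρ | 𝒜.IsState ρ ∧ traceNorm (ρ - ρ₁) < ENNReal.ofReal δ}

/-- The sub-basic condition `N(ρ₀, A, δ) = {ρ : |Tr ρ A - Tr ρ₀ A| < δ}` in the smooth state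
space. -/
def subNu (𝒜 : OStarAlgebra H) (ρ₀ : H →L[ℂ] H) (A : Module.End ℂ 𝒜.domain) (δ : ℝ) :
    Set (H →L[ℂ] H) :=
  {ρ | 𝒜.IsState ρ ∧ ‖expect A ρ - expect A ρ₀‖ < δ}

/-- A strongly continuous one-parameter unitary group. -/
structure UnitaryGroup (H : Type*) [NormedAddCommGroup H] [InnerProductSpace ℂ H] where
  U : ℝ → H ≃ₗᵢ[ℂ] H
  map_add : ∀ s t x, U (s + t) x = U s (U t x)
  continuous_apply : ∀ x, Continuous fun t => U t x

/-- `ρ ↦ V ρ V*` for a unitary `V`. -/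
def conj (V : H ≃ₗᵢ[ℂ] H) (ρ : H →L[ℂ] H) : H →L[ℂ] H :=
  (V.toContinuousLinearEquiv : H →L[ℂ] H) ∘L ρ ∘L (V.symm.toContinuousLinearEquiv : H →L[ℂ] H)

/-- The condition `W` at time `t₁` evolves to `W'` at time `t₂`: `W' = U(t₂-t₁) W U(t₂-t₁)*`. -/
def EvolvesTo (G : UnitaryGroup H) (t₁ t₂ : ℝ) (W W' : Set (H →L[ℂ] H)) : Prop :=
  conj (G.U (t₂ - t₁)) '' W = W'

/-- The unitary group acts on the smooth state space of `𝒜`. -/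
def ActsOnStates (G : UnitaryGroup H) (𝒜 : OStarAlgebra H) : Prop :=
  ∀ t ρ, 𝒜.IsState ρ → 𝒜.IsState (conj (G.U t) ρ)

end Trace

/-- The self-adjoint operator of multiplication by a real function `g` on `L²(Y, ν)`, on its
maximal domain. -/
def multOp {Y : Type*} [MeasurableSpace Y] (ν : Measure Y) (g : Y → ℝ) :
    Lp ℂ 2 ν →ₗ.[ℂ] Lp ℂ 2 ν where
  domain :=
    { carrier := {u | MemLp (fun y => (g y : ℂ) * u y) 2 ν}
      add_mem' := by
        intro u v hu hv
        refine (MemLp.add hu hv).ae_eq ?_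
        filter_upwards [Lp.coeFn_add u v] with y hy
        rw [hy, Pi.add_apply, Pi.add_apply, mul_add]
      zero_mem' := by
        refine (MemLp.zero (p := 2) (μ := ν) (ε := ℂ)).ae_eq ?_
        filter_upwards [Lp.coeFn_zero ℂ 2 ν] with y hy
        rw [hy, Pi.zero_apply, mul_zero]
      smul_mem' := by
        intro c u hu
        refine (MemLp.const_smul hu c).ae_eq ?_
        filter_upwards [Lp.coeFn_smul c u] with y hy
        rw [hy, Pi.smul_apply, Pi.smul_apply, smul_eq_mul, smul_eq_mul, mul_left_comm] }
  toFun :=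
    { toFun := fun u => MemLp.toLp (fun y => (g y : ℂ) * u.1 y) u.2
      map_add' := by
        intro u v
        rw [← MemLp.toLp_add]
        refine MemLp.toLp_congr _ _ ?_
        filter_upwards [Lp.coeFn_add u.1 v.1] with y hy
        rw [Submodule.coe_add, hy, Pi.add_apply, Pi.add_apply, mul_add]
      map_smul' := by
        intro c u
        rw [RingHom.id_apply, ← MemLp.toLp_const_smul]
        refine MemLp.toLp_congr _ _ ?_
        filter_upwards [Lp.coeFn_smul c u.1] with y hy
        rw [Submodule.coe_smul, hy, Pi.smul_apply, Pi.smul_apply, smul_eq_mul, smul_eq_mul,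
          mul_left_comm] }

/-- The coordinate space `ℝ^d`. -/
abbrev Sp (d : ℕ) := EuclideanSpace ℝ (Fin d)

/-- The unit vector in direction `j`. -/
abbrev dir {d : ℕ} (j : Fin d) : Sp d := EuclideanSpace.single j (1 : ℝ)

section Interaction

variable {d : ℕ} {X : Type*} [MeasurableSpace X] (μ : Measure X)

/-- The joint Hilbert space `L²(X, μ) ⊗ L²(ℝ^d) = L²(X × ℝ^d)`. -/
abbrev Joint (d : ℕ) {X : Type*} [MeasurableSpace X] (μ : Measure X) :=
  Lp ℂ 2 (μ.prod (volume : Measure (Sp d)))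

theorem memLp_tensor (u : Lp ℂ 2 μ) (v : Lp ℂ 2 (volume : Measure (Sp d))) :
    MemLp (fun z : X × Sp d => u z.1 * v z.2) 2 (μ.prod (volume : Measure (Sp d))) := by
  have hu := (memLp_two_iff_integrable_sq_norm (Lp.memLp u).1).1 (Lp.memLp u)
  have hv := (memLp_two_iff_integrable_sq_norm (Lp.memLp v).1).1 (Lp.memLp v)
  refine (memLp_two_iff_integrable_sq_norm
    ((Lp.memLp u).1.comp_fst.mul (Lp.memLp v).1.comp_snd)).2 ?_
  simpa [mul_pow] using hu.mul_prod hv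

variable {μ} in
/-- The product wave function `(u ⊗ v)(x, y) = u(x) v(y)`. -/
def tensor (u : Lp ℂ 2 μ) (v : Lp ℂ 2 (volume : Measure (Sp d))) : Joint d μ :=
  (memLp_tensor μ u v).toLp

/-- A joint wave function is entangled if it is not a product wave function. -/
def IsEntangled (Ψ : Joint d μ) : Prop :=
  ¬ ∃ (u : Lp ℂ 2 μ) (v : Lp ℂ 2 (volume : Measure (Sp d))), Ψ = tensor u v

/-- The momentum operator `-i ħ ∂_m` in direction `m` on Schwartz functions. -/
def momentum (ħ : ℝ) {V : Type*} [NormedAddCommGroup V] [NormedSpace ℝ V] (m : V) :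
    𝓢(V, ℂ) →ₗ[ℂ] 𝓢(V, ℂ) :=
  (-(Complex.I * ħ)) • (LineDeriv.lineDerivOpCLM ℂ 𝓢(V, ℂ) m).toLinearMap

/-- The value of `γ ∑ j, Q_{S,j} ⊗ P_{M,j}` on `u ⊗ f`. Here `Q_{S,j}` is multiplication by
the `j`-th component of `q`, `u` lies in the domains of these operators, `P_{M,j} = -i ħ ∂_j`,
and `f` is a Schwartz function. -/
def impulsive (q : X → Sp d) (γ ħ : ℝ) (u : Lp ℂ 2 μ)
    (hu : ∀ j, u ∈ (multOp μ fun x => q x j).domain) (f : 𝓢(Sp d, ℂ)) : Joint d μ :=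
  (γ : ℂ) • ∑ j, tensor (multOp μ (fun x => q x j) ⟨u, hu j⟩) ((momentum ħ (dir j) f).toLp 2)

/-- `U(t) = exp (σ i Ĥ t / ħ)` for the Hamiltonian `Ĥ = γ ∑ j, Q_{S,j} ⊗ P_{M,j}` with domain the
span of the vectors `u ⊗ f` as above. -/
def IsGenerated (q : X → Sp d) (γ ħ σ : ℝ) (G : UnitaryGroup (Joint d μ)) : Prop :=
  ∀ (u : Lp ℂ 2 μ) (hu : ∀ j, u ∈ (multOp μ fun x => q x j).domain) (f : 𝓢(Sp d, ℂ)),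
    HasDerivAt (fun t => G.U t (tensor u (f.toLp 2)))
      ((σ * Complex.I / ħ : ℂ) • impulsive μ q γ ħ u hu f) 0

variable {μ} in
/-- `A` is the restriction of `Q_{S,j} ⊗ I` to the common domain of `𝒜`. -/
def IsMeasurand (q : X → Sp d) (j : Fin d) (𝒜 : OStarAlgebra (Joint d μ))
    (A : Module.End ℂ 𝒜.domain) : Prop :=
  ∀ Φ : 𝒜.domain, ∃ h : (Φ : Joint d μ) ∈ (multOp (μ.prod volume) fun z => q z.1 j).domain,
    (A Φ : Joint d μ) = multOp (μ.prod volume) (fun z => q z.1 j) ⟨Φ, h⟩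

variable {μ} in
/-- `ψ` is an eigenvector of `Q_S = (Q_{S,1}, …, Q_{S,d})` for the eigenvalue `l` (provided that
`ψ ≠ 0`). -/
def IsEigen (q : X → Sp d) (l : Sp d) (ψ : Lp ℂ 2 μ) : Prop :=
  ∀ j, ∃ h : ψ ∈ (multOp μ fun x => q x j).domain,
    multOp μ (fun x => q x j) ⟨ψ, h⟩ = (l j : ℂ) • ψ

variable {μ} in
/-- The pointer wave function `φ'(y) = ∫ |ψ(x)|² φ(y + s q(x)) dμ(x)`. -/
def IsPointer (q : X → Sp d) (s : ℝ) (ψ : Lp ℂ 2 μ)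
    (φ φ' : Lp ℂ 2 (volume : Measure (Sp d))) : Prop :=
  ∀ᵐ y, φ' y = ∫ x, ((‖ψ x‖ ^ 2 : ℝ) : ℂ) * φ (y + s • q x) ∂μ

end Interaction

section Weyl

instance hasTemperateGrowth_prod (d : ℕ) :
    ((volume : Measure (Sp d)).prod (volume : Measure (Sp d))).HasTemperateGrowth := by
  have : ((volume : Measure (Sp d)).prod (volume : Measure (Sp d))).IsAddHaarMeasure :=
    Measure.prod.instIsAddHaarMeasure _ _
  exact Measure.IsAddHaarMeasure.instHasTemperateGrowth

/-- Multiplication by a real function of temperate growth on Schwartz functions. -/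
def position {V : Type*} [NormedAddCommGroup V] [NormedSpace ℝ V] (g : V → ℝ) :
    𝓢(V, ℂ) →ₗ[ℂ] 𝓢(V, ℂ) :=
  (SchwartzMap.smulLeftCLM ℂ fun z => (g z : ℂ)).toLinearMap

/-- The positions and momenta of two particles in `ℝ^d`, acting on Schwartz functions of the pair
of their coordinates. -/
def weylGenerators (d : ℕ) (ħ : ℝ) : Set (Module.End ℂ 𝓢(Sp d × Sp d, ℂ)) :=
  Set.range (fun j : Fin d => position fun z : Sp d × Sp d => z.1 j) ∪
  Set.range (fun j : Fin d => position fun z : Sp d × Sp d => z.2 j) ∪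
  Set.range (fun j : Fin d => momentum ħ ((dir j, 0) : Sp d × Sp d)) ∪
  Set.range (fun j : Fin d => momentum ħ ((0, dir j) : Sp d × Sp d))

/-- The inclusion of the Schwartz space in `L²(ℝ^d × ℝ^d)`. -/
def schwartzIncl (d : ℕ) :
    𝓢(Sp d × Sp d, ℂ) →ₗ[ℂ] Joint d (volume : Measure (Sp d)) :=
  (SchwartzMap.toLpCLM ℂ ℂ 2
    ((volume : Measure (Sp d)).prod (volume : Measure (Sp d)))).toLinearMap

theorem schwartzIncl_injective (d : ℕ) : Function.Injective (schwartzIncl d) :=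
  SchwartzMap.injective_toLp 2 ((volume : Measure (Sp d)).prod (volume : Measure (Sp d)))

theorem schwartzIncl_dense (d : ℕ) : DenseRange (schwartzIncl d) := by
  have h : DenseRange (SchwartzMap.toLpCLM ℝ ℂ 2
      ((volume : Measure (Sp d)).prod (volume : Measure (Sp d)))) :=
    SchwartzMap.denseRange_toLpCLM (p := 2) (by norm_num)
  exact h

theorem inner_schwartzIncl (d : ℕ) (f g : 𝓢(Sp d × Sp d, ℂ)) :
    ⟪schwartzIncl d f, schwartzIncl d g⟫_ℂ =
      ∫ z, (starRingEnd ℂ) (f z) * g z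
        ∂((volume : Measure (Sp d)).prod (volume : Measure (Sp d))) := by
  rw [L2.inner_def]
  refine integral_congr_ae ?_
  filter_upwards [f.coeFn_toLp 2 ((volume : Measure (Sp d)).prod (volume : Measure (Sp d))),
    g.coeFn_toLp 2 ((volume : Measure (Sp d)).prod (volume : Measure (Sp d)))] with z hf hg
  have h1 : (schwartzIncl d f : Sp d × Sp d → ℂ) z = f z := hf
  have h2 : (schwartzIncl d g : Sp d × Sp d → ℂ) z = g z := hg
  rw [h1, h2, RCLike.inner_apply, mul_comm]

theorem position_symm (d : ℕ) (g : Sp d × Sp d → ℝ)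
    (hg : (fun z => (g z : ℂ)).HasTemperateGrowth) (f₁ f₂ : 𝓢(Sp d × Sp d, ℂ)) :
    ⟪schwartzIncl d (position g f₁), schwartzIncl d f₂⟫_ℂ =
      ⟪schwartzIncl d f₁, schwartzIncl d (position g f₂)⟫_ℂ := by
  rw [inner_schwartzIncl, inner_schwartzIncl]
  refine integral_congr_ae (Filter.Eventually.of_forall fun z => ?_)
  simp [position, SchwartzMap.smulLeftCLM_apply_apply hg]
  ring

theorem momentum_symm (d : ℕ) (ħ : ℝ) (m : Sp d × Sp d) (f₁ f₂ : 𝓢(Sp d × Sp d, ℂ)) :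
    ⟪schwartzIncl d (momentum ħ m f₁), schwartzIncl d f₂⟫_ℂ =
      ⟪schwartzIncl d f₁, schwartzIncl d (momentum ħ m f₂)⟫_ℂ := by
  have key := SchwartzMap.integral_bilinear_lineDerivOp_right_eq_neg_left
    (μ := (volume : Measure (Sp d)).prod (volume : Measure (Sp d))) f₁ f₂
    ((ContinuousLinearMap.mul ℝ ℂ).comp (Complex.conjCLE : ℂ →L[ℝ] ℂ)) m
  simp only [momentum, LinearMap.smul_apply, map_smul, inner_smul_left, inner_smul_right]
  rw [inner_schwartzIncl, inner_schwartzIncl]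
  have e1 : ∫ z, (starRingEnd ℂ) (f₁ z) * (∂_{m} f₂) z
      ∂((volume : Measure (Sp d)).prod (volume : Measure (Sp d))) =
      -∫ z, (starRingEnd ℂ) ((∂_{m} f₁) z) * f₂ z
      ∂((volume : Measure (Sp d)).prod (volume : Measure (Sp d))) := by
    simpa using key
  have e2 : ∀ f : 𝓢(Sp d × Sp d, ℂ),
      (LineDeriv.lineDerivOpCLM ℂ 𝓢(Sp d × Sp d, ℂ) m).toLinearMap f = ∂_{m} f := fun _ => rfl
  rw [e2, e2, e1]
  simp

theorem weylGenerators_symm (d : ℕ) (ħ : ℝ) (A : Module.End ℂ 𝓢(Sp d × Sp d, ℂ))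
    (hA : A ∈ weylGenerators d ħ) (f₁ f₂ : 𝓢(Sp d × Sp d, ℂ)) :
    ⟪schwartzIncl d (A f₁), schwartzIncl d f₂⟫_ℂ =
      ⟪schwartzIncl d f₁, schwartzIncl d (A f₂)⟫_ℂ := by
  have hlin : ∀ L : Sp d × Sp d →L[ℝ] ℝ, (fun z => ((L z : ℝ) : ℂ)).HasTemperateGrowth :=
    fun L => (Complex.ofRealCLM.comp L).hasTemperateGrowth
  rcases hA with ((⟨j, rfl⟩ | ⟨j, rfl⟩) | ⟨j, rfl⟩) | ⟨j, rfl⟩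
  · exact position_symm d _
      (hlin ((EuclideanSpace.proj j).comp (ContinuousLinearMap.fst ℝ _ _))) f₁ f₂
  · exact position_symm d _
      (hlin ((EuclideanSpace.proj j).comp (ContinuousLinearMap.snd ℝ _ _))) f₁ f₂
  · exact momentum_symm d ħ _ f₁ f₂
  · exact momentum_symm d ħ _ f₁ f₂

theorem weyl_exists_adjoint (d : ℕ) (ħ : ℝ) (A : Module.End ℂ 𝓢(Sp d × Sp d, ℂ))
    (hA : A ∈ Algebra.adjoin ℂ (weylGenerators d ħ)) :
    ∃ B ∈ Algebra.adjoin ℂ (weylGenerators d ħ), ∀ f₁ f₂,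
      ⟪schwartzIncl d (A f₁), schwartzIncl d f₂⟫_ℂ =
        ⟪schwartzIncl d f₁, schwartzIncl d (B f₂)⟫_ℂ := by
  induction hA using Algebra.adjoin_induction with
  | mem A h => exact ⟨A, Algebra.subset_adjoin h, weylGenerators_symm d ħ A h⟩
  | algebraMap r =>
    refine ⟨algebraMap ℂ _ ((starRingEnd ℂ) r), Subalgebra.algebraMap_mem _ _, fun f₁ f₂ => ?_⟩
    simp [Module.algebraMap_end_apply, inner_smul_left, inner_smul_right]
  | add A₁ A₂ _ _ h₁ h₂ =>
    obtain ⟨B₁, hB₁, e₁⟩ := h₁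
    obtain ⟨B₂, hB₂, e₂⟩ := h₂
    refine ⟨B₁ + B₂, add_mem hB₁ hB₂, fun f₁ f₂ => ?_⟩
    simp [inner_add_left, inner_add_right, e₁, e₂]
  | mul A₁ A₂ _ _ h₁ h₂ =>
    obtain ⟨B₁, hB₁, e₁⟩ := h₁
    obtain ⟨B₂, hB₂, e₂⟩ := h₂
    refine ⟨B₂ * B₁, mul_mem hB₂ hB₁, fun f₁ f₂ => ?_⟩
    simp [e₁, e₂]

/-- The O*-algebra of two (spinless) particles in the Schrödinger representation: the algebra
generated by their positions and momenta on the Schwartz space. -/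
def weylAlgebra (d : ℕ) (ħ : ℝ) : OStarAlgebra (Joint d (volume : Measure (Sp d))) :=
  OStarAlgebra.ofInjective (schwartzIncl d) (schwartzIncl_injective d) (schwartzIncl_dense d)
    (Algebra.adjoin ℂ (weylGenerators d ħ)) (weyl_exists_adjoint d ħ)

end Weyl

end QRNumber

end

/-!
The generator on `u ⊗ f` is `σ γ ∑ j, q_j u ⊗ ∂_j f`, so the unitary group has to be the shear
`(U(t) Φ)(x, y) = Φ(x, y + σ γ t q(x))`. Everything else is read off from this formula.

*Existence.* On the slice over `x` the difference quotient of `u ⊗ f` differs from its limit by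
`u(x) (T_b f - f - b · ∇f) / s`, `b = s q(x)`, where `T_b` is translation by `b`. The remainder has
norm at most `C min(‖b‖, ‖b‖²)` (`norm_translateRemainder_le`). The first bound is a majorant, as
`q_j u` is square integrable, the second one gives convergence to zero (`hasDerivAt_shear`).

*Uniqueness.* Let `G` be any group with this generator. The domain need not be invariant under the
shear by `q`, and `u ⊗ f` need not be an analytic vector; so `q` is replaced by a simple function
`p` with `‖q - p‖ ≤ ε` on a set `A` where `q` is bounded. The shear by `p` maps `1_A ⊗ f` to a
finite sum of vectors `1_B ⊗ g`, which lie in the domain. Hence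
`G(-t) (shear by p at time t) (1_A ⊗ f)` is differentiable, with derivative `O(ε)`, and `G(t)` is
within `O(ε |t|)` of the shear by `p` (`norm_sub_shear_le`). The shear by `q` is too, and the vectors `1_A ⊗ f` are total
(`eq_zero_of_inner_tensor`), so that `G` is the shear group (`IsGenerated.apply_eq`).

*Conditions.* Unitary conjugation preserves the trace norm and the trace of trace class operators.
The latter is the independence of the trace from the basis (`trace_eq`), which follows from the
polar decomposition `T = (W |T|^(1/2)) |T|^(1/2)` and from `Tr A* S = Tr S A*` for Hilbert–Schmidt
operators. The measurand commutes with the shear, so that its expectation values do not change.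

*Eigenvectors.* Where an eigenvector `ψ` for `l` does not vanish, `q = l`; hence
`U(t) (ψ ⊗ φ) = ψ ⊗ T_{s l} φ`. If `α ψ⁺ ⊗ T_a φ + β ψ⁻ ⊗ T_b φ` were a product, partial inner
products with `ψ⁺` and `ψ⁻` would show `T_a φ` to be a multiple of `T_b φ`. Then `|φ|` would be
periodic, which Poincaré recurrence for the finite measure `|φ|² dy` excludes unless `a = b`.

*Approximate eigenvectors.* The pointer wave function is the partial inner product of `ψ` with
`U(t) (ψ ⊗ φ)`. As translations act continuously on `L²`, the latter is close to `ψ ⊗ T_{s l} φ`,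
and so is `ψ ⊗` the pointer wave function.

*Two particles.* The shear is a linear change of coordinates. It preserves the Schwartz space, and
conjugation by it maps positions and momenta to linear combinations of positions and momenta.
-/

noncomputable section

namespace QRNumber

/-! ### Traces and unitary conjugation -/

section Trace

variable {H : Type*} [NormedAddCommGroup H] [InnerProductSpace ℂ H]

theorem tsum_enorm_inner_sq {ι : Type*} (b : HilbertBasis ι ℂ H) (x : H) :
    ∑' i, ‖⟪b i, x⟫_ℂ‖ₑ ^ 2 = ‖x‖ₑ ^ 2 := by
  have h := (b.hasSum_inner_mul_inner x x).mapL Complex.reCLM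
  have e : ∀ i, Complex.reCLM (⟪x, b i⟫_ℂ * ⟪b i, x⟫_ℂ) = ‖⟪b i, x⟫_ℂ‖ ^ 2 := fun i => by
    rw [← inner_conj_symm x (b i), ← Complex.normSq_eq_conj_mul_self, Complex.reCLM_apply,
      Complex.ofReal_re, Complex.normSq_eq_norm_sq]
  simp only [e] at h
  have h2 : Complex.reCLM ⟪x, x⟫_ℂ = ‖x‖ ^ 2 := inner_self_eq_norm_sq (𝕜 := ℂ) x
  rw [h2] at h
  have h3 := ENNReal.ofReal_tsum_of_nonneg (fun i => by positivity) h.summable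
  rw [h.tsum_eq] at h3
  simpa only [← ofReal_norm, ENNReal.ofReal_pow (norm_nonneg _)] using h3.symm

/-- The Hilbert basis `V⁻¹ bᵢ`. -/
def pullBasis {ι : Type*} (b : HilbertBasis ι ℂ H) (V : H ≃ₗᵢ[ℂ] H) : HilbertBasis ι ℂ H :=
  HilbertBasis.ofRepr (V.trans b.repr)

theorem pullBasis_apply {ι : Type*} (b : HilbertBasis ι ℂ H) (V : H ≃ₗᵢ[ℂ] H) (i : ι) :
    pullBasis b V i = V.symm (b i) := by
  classical
  rw [← (pullBasis b V).repr_symm_single, ← b.repr_symm_single]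
  rfl

theorem conj_apply (V : H ≃ₗᵢ[ℂ] H) (T : H →L[ℂ] H) (x : H) : conj V T x = V (T (V.symm x)) := rfl

theorem conj_proj (V : H ≃ₗᵢ[ℂ] H) (Ψ : H) : conj V (proj Ψ) = proj (V Ψ) := by
  ext x
  rw [conj_apply, proj, proj, InnerProductSpace.rankOne_apply, InnerProductSpace.rankOne_apply,
    map_smul, ← V.inner_map_map, V.apply_symm_apply]

theorem UnitaryGroup.map_zero (G : UnitaryGroup H) (x : H) : G.U 0 x = x :=
  (G.U 0).injective (by rw [← G.map_add, add_zero])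

theorem UnitaryGroup.map_map_neg (G : UnitaryGroup H) (t : ℝ) (x : H) :
    G.U t (G.U (-t) x) = x := by
  rw [← G.map_add, add_neg_cancel, G.map_zero]

theorem UnitaryGroup.symm_apply (G : UnitaryGroup H) (t : ℝ) (x : H) :
    (G.U t).symm x = G.U (-t) x := by
  rw [LinearIsometryEquiv.symm_apply_eq, G.map_map_neg]

theorem UnitaryGroup.conj_conj_neg (G : UnitaryGroup H) (t : ℝ) (ρ : H →L[ℂ] H) :
    conj (G.U t) (conj (G.U (-t)) ρ) = ρ := by
  ext x
  rw [conj_apply, conj_apply, G.map_map_neg, G.symm_apply, G.symm_apply, neg_neg, G.map_map_neg]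

variable [CompleteSpace H]

theorem tsum_enorm_apply_sq_adjoint {ι κ : Type*} (b : HilbertBasis ι ℂ H)
    (c : HilbertBasis κ ℂ H) (T : H →L[ℂ] H) :
    ∑' i, ‖T (b i)‖ₑ ^ 2 = ∑' j, ‖T.adjoint (c j)‖ₑ ^ 2 := by
  simp only [← tsum_enorm_inner_sq c (T _), ← tsum_enorm_inner_sq b (T.adjoint _)]
  rw [ENNReal.tsum_comm]
  refine tsum_congr fun j => tsum_congr fun i => ?_
  rw [T.adjoint_inner_right, ← ofReal_norm, ← ofReal_norm, norm_inner_symm]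

/-- The Hilbert–Schmidt norm does not depend on the Hilbert basis. -/
theorem tsum_enorm_apply_sq_eq {ι κ : Type*} (b : HilbertBasis ι ℂ H)
    (c : HilbertBasis κ ℂ H) (T : H →L[ℂ] H) :
    ∑' i, ‖T (b i)‖ₑ ^ 2 = ∑' j, ‖T (c j)‖ₑ ^ 2 := by
  rw [tsum_enorm_apply_sq_adjoint b b, ← tsum_enorm_apply_sq_adjoint c b]

/-- The square root of `|T|`. -/
def sqrtAbs (T : H →L[ℂ] H) : H →L[ℂ] H := CFC.sqrt (CFC.abs T)

theorem sqrtAbs_adjoint (T : H →L[ℂ] H) : (sqrtAbs T).adjoint = sqrtAbs T :=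
  ContinuousLinearMap.isSelfAdjoint_iff'.1
    ((ContinuousLinearMap.nonneg_iff_isPositive (sqrtAbs T)).1
      (CFC.sqrt_nonneg (CFC.abs T))).isSelfAdjoint

theorem sqrtAbs_sqrtAbs (T : H →L[ℂ] H) (x : H) : sqrtAbs T (sqrtAbs T x) = CFC.abs T x :=
  congrArg (fun A : H →L[ℂ] H => A x) (CFC.sqrt_mul_sqrt_self (CFC.abs T) (CFC.abs_nonneg T))

theorem ofReal_re_inner_abs (T : H →L[ℂ] H) (x : H) :
    ENNReal.ofReal (⟪x, CFC.abs T x⟫_ℂ).re = ‖sqrtAbs T x‖ₑ ^ 2 := by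
  have h2 : (⟪sqrtAbs T x, sqrtAbs T x⟫_ℂ).re = ‖sqrtAbs T x‖ ^ 2 :=
    inner_self_eq_norm_sq (𝕜 := ℂ) _
  rw [← sqrtAbs_sqrtAbs, ← (sqrtAbs T).adjoint_inner_left, sqrtAbs_adjoint, h2,
    ENNReal.ofReal_pow (norm_nonneg _), ofReal_norm]

theorem traceNorm_eq {ι : Type*} (b : HilbertBasis ι ℂ H) (T : H →L[ℂ] H) :
    traceNorm T = ∑' i, ‖sqrtAbs T (b i)‖ₑ ^ 2 := by
  rw [tsum_enorm_apply_sq_eq b (basisVec H)]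
  exact tsum_congr fun i => ofReal_re_inner_abs T _

theorem conj_eq_conjStarAlgEquiv (V : H ≃ₗᵢ[ℂ] H) (T : H →L[ℂ] H) :
    conj V T = V.conjStarAlgEquiv T := rfl

theorem isPositive_conj (V : H ≃ₗᵢ[ℂ] H) {T : H →L[ℂ] H} (hT : T.IsPositive) :
    (conj V T).IsPositive := by
  rw [← ContinuousLinearMap.nonneg_iff_isPositive] at hT ⊢
  rw [conj_eq_conjStarAlgEquiv, StarOrderedRing.nonneg_iff] at *
  induction hT using AddSubmonoid.closure_induction with
  | mem x hx =>
    obtain ⟨s, rfl⟩ := hx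
    exact AddSubmonoid.subset_closure ⟨V.conjStarAlgEquiv s, by simp [map_star]⟩
  | zero => simp
  | add x y _ _ hx hy => rw [map_add]; exact add_mem hx hy

theorem abs_conj (V : H ≃ₗᵢ[ℂ] H) (T : H →L[ℂ] H) :
    CFC.abs (conj V T) = conj V (CFC.abs T) := by
  refine CFC.sqrt_unique ?_ ?_
  · simp only [conj_eq_conjStarAlgEquiv]
    rw [← map_mul, CFC.abs_mul_abs, map_mul, map_star]
  · rw [ContinuousLinearMap.nonneg_iff_isPositive]
    exact isPositive_conj V ((ContinuousLinearMap.nonneg_iff_isPositive _).1 (CFC.abs_nonneg T))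

theorem traceNorm_conj (V : H ≃ₗᵢ[ℂ] H) (T : H →L[ℂ] H) :
    traceNorm (conj V T) = traceNorm T := by
  rw [traceNorm_eq (pullBasis (basisVec H) V) T, traceNorm]
  refine tsum_congr fun i => ?_
  rw [← ofReal_re_inner_abs, abs_conj, conj_apply, pullBasis_apply, ← V.symm.inner_map_map,
    V.symm_apply_apply]

/-- Polar decomposition `T = W |T|`: the map `|T| x ↦ T x` is isometric, and `W` extends it by
continuity to the closure `K` of the range of `|T|` and by zero to the complement of `K`. -/
theorem exists_polar (T : H →L[ℂ] H) : ∃ W : H →L[ℂ] H, ∀ x, W (CFC.abs T x) = T x := by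
  have hn : ∀ x, ‖T x‖ = ‖CFC.abs T x‖ := fun x => by
    have h : T.adjoint (T x) = CFC.abs T (CFC.abs T x) :=
      congrArg (fun A : H →L[ℂ] H => A x) (CFC.abs_mul_abs T).symm
    have hs : (CFC.abs T).adjoint = CFC.abs T :=
      ((ContinuousLinearMap.nonneg_iff_isPositive _).1 (CFC.abs_nonneg T)).isSelfAdjoint.adjoint_eq
    have h1 : ⟪T x, T x⟫_ℂ = ⟪CFC.abs T x, CFC.abs T x⟫_ℂ := by
      rw [← T.adjoint_inner_right, h, ← (CFC.abs T).adjoint_inner_right, hs]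
    rw [inner_self_eq_norm_sq_to_K, inner_self_eq_norm_sq_to_K] at h1
    exact (sq_eq_sq₀ (norm_nonneg _) (norm_nonneg _)).1 (by exact_mod_cast h1)
  let K : Submodule ℂ H := (CFC.abs T).toLinearMap.range.topologicalClosure
  have hK : ∀ x, CFC.abs T x ∈ K := fun x => Submodule.le_topologicalClosure _ ⟨x, rfl⟩
  let e : H →ₗ[ℂ] K := (CFC.abs T).toLinearMap.codRestrict K hK
  have hd : DenseRange e := by
    intro y
    rw [closure_subtype]
    have : (Subtype.val '' Set.range e : Set H) = (CFC.abs T).toLinearMap.range := by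
      ext z
      simp only [Set.mem_image, Set.mem_range, exists_exists_eq_and]
      rfl
    rw [this]
    exact y.2
  refine ⟨(T.toLinearMap.extendOfNorm e) ∘L K.orthogonalProjectionOnto, fun x => ?_⟩
  have h1 : K.orthogonalProjectionOnto (CFC.abs T x) = e x :=
    Submodule.orthogonalProjectionOnto_mem_subspace_eq_self (⟨CFC.abs T x, hK x⟩ : K)
  rw [ContinuousLinearMap.comp_apply, h1]
  exact LinearMap.extendOfNorm_eq hd ⟨1, fun z => by rw [one_mul]; exact (hn z).le⟩ x

/-- For Hilbert–Schmidt operators `A`, `S` with `S` self-adjoint, `Tr (A* S) = Tr (S A*)`,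
whichever bases are used to evaluate the two sides. -/
theorem tsum_inner_comm {ι κ : Type*} (b : HilbertBasis ι ℂ H) (c : HilbertBasis κ ℂ H)
    (A S : H →L[ℂ] H) (hS : S.adjoint = S) (hA2 : ∑' i, ‖A (b i)‖ₑ ^ 2 ≠ ∞)
    (hS2 : ∑' i, ‖S (b i)‖ₑ ^ 2 ≠ ∞) :
    ∑' i, ⟪A (b i), S (b i)⟫_ℂ = ∑' j, ⟪S (c j), A.adjoint (c j)⟫_ℂ := by
  have key : ∀ B : H →L[ℂ] H, ∑' i, ‖B (b i)‖ₑ ^ 2 ≠ ∞ →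
      Summable fun p : κ × ι => ‖⟪B (b p.2), c p.1⟫_ℂ‖ ^ 2 := fun B hB => by
    have h : ∑' p : κ × ι, ‖(‖⟪B (b p.2), c p.1⟫_ℂ‖ ^ 2 : ℝ)‖ₑ ≠ ∞ := by
      rw [ENNReal.tsum_prod (f := fun j i => ‖(‖⟪B (b i), c j⟫_ℂ‖ ^ 2 : ℝ)‖ₑ), ENNReal.tsum_comm]
      convert hB using 3 with i
      rw [← tsum_enorm_inner_sq c]
      refine tsum_congr fun j => ?_
      rw [enorm_pow, enorm_norm, ← ofReal_norm, ← ofReal_norm, norm_inner_symm]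
    simpa using tsum_enorm_ne_top_iff_summable_norm.1 h
  have hs : Summable (Function.uncurry fun j i => ⟪A (b i), c j⟫_ℂ * ⟪c j, S (b i)⟫_ℂ) := by
    refine Summable.of_norm_bounded ((key A hA2).add (key S hS2)) fun p => ?_
    rw [Function.uncurry_def, norm_mul, norm_inner_symm (c p.1)]
    nlinarith [sq_nonneg (‖⟪A (b p.2), c p.1⟫_ℂ‖ - ‖⟪S (b p.2), c p.1⟫_ℂ‖),
      sq_nonneg (‖⟪A (b p.2), c p.1⟫_ℂ‖), sq_nonneg (‖⟪S (b p.2), c p.1⟫_ℂ‖)]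
  have h := hs.tsum_comm
  rw [tsum_congr fun i => c.tsum_inner_mul_inner (A (b i)) (S (b i))] at h
  rw [h]
  refine tsum_congr fun j => ?_
  rw [← b.tsum_inner_mul_inner]
  refine tsum_congr fun i => ?_
  rw [mul_comm, A.adjoint_inner_right, ← S.adjoint_inner_right, hS]

/-- Any polar decomposition `T = W S S`, `S = |T|^(1/2)`, turns the sum of the diagonal matrix
elements of `T` into that of `S W S`, with a possibly different basis. -/
theorem tsum_inner_eq_of_polar {ι κ : Type*} (b : HilbertBasis ι ℂ H) (c : HilbertBasis κ ℂ H)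
    {T W : H →L[ℂ] H} (hT : IsTraceClass T) (hW : ∀ x, W (CFC.abs T x) = T x) :
    ∑' j, ⟪c j, T (c j)⟫_ℂ = ∑' i, ⟪sqrtAbs T (b i), W (sqrtAbs T (b i))⟫_ℂ := by
  have hS2 : ∑' j, ‖sqrtAbs T (c j)‖ₑ ^ 2 ≠ ∞ := by
    rw [← traceNorm_eq]; exact hT.ne
  have h := tsum_inner_comm c b ((W ∘L sqrtAbs T).adjoint) (sqrtAbs T) (sqrtAbs_adjoint T) ?_ hS2
  · rw [ContinuousLinearMap.adjoint_adjoint] at h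
    simp only [ContinuousLinearMap.comp_apply] at h
    rw [← h]
    refine tsum_congr fun j => ?_
    rw [ContinuousLinearMap.adjoint_inner_left, ContinuousLinearMap.comp_apply,
      sqrtAbs_sqrtAbs, hW]
  · rw [← tsum_enorm_apply_sq_adjoint c c]
    refine ne_top_of_le_ne_top (ENNReal.mul_ne_top (a := ‖W‖ₑ ^ 2) (by finiteness) hS2) ?_
    rw [← ENNReal.tsum_mul_left]
    refine ENNReal.tsum_le_tsum fun j => ?_
    rw [← mul_pow]
    gcongr
    exact W.le_opENorm _

/-- The trace of a trace class operator does not depend on the Hilbert basis. -/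
theorem trace_eq {ι : Type*} (b : HilbertBasis ι ℂ H) {T : H →L[ℂ] H} (hT : IsTraceClass T) :
    trace T = ∑' i, ⟪b i, T (b i)⟫_ℂ := by
  obtain ⟨W, hW⟩ := exists_polar T
  rw [tsum_inner_eq_of_polar b b hT hW]
  exact tsum_inner_eq_of_polar b (basisVec H) hT hW

theorem trace_conj (V : H ≃ₗᵢ[ℂ] H) {T : H →L[ℂ] H} (hT : IsTraceClass T) :
    trace (conj V T) = trace T := by
  rw [trace_eq (pullBasis (basisVec H) V) hT, trace]
  refine tsum_congr fun i => ?_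
  rw [conj_apply, pullBasis_apply, ← V.symm.inner_map_map, V.symm_apply_apply]

theorem isTraceClass_rankOne (a : H) {Ψ : H} (hΨ : ‖Ψ‖ = 1) :
    IsTraceClass (InnerProductSpace.rankOne ℂ a Ψ) := by
  have hp : CFC.abs (InnerProductSpace.rankOne ℂ a Ψ) = ‖a‖ • InnerProductSpace.rankOne ℂ Ψ Ψ := by
    refine CFC.sqrt_unique ?_ ?_
    · ext x
      have h (c : ℂ) : ‖a‖ ^ 2 • c • Ψ = (c * (‖a‖ : ℂ) ^ 2) • Ψ := by
        rw [← Complex.coe_smul, smul_smul, mul_comm, Complex.ofReal_pow]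
      simp [ContinuousLinearMap.star_eq_adjoint, hΨ, smul_smul, h, ← sq]
    · exact smul_nonneg (norm_nonneg _) ((ContinuousLinearMap.nonneg_iff_isPositive _).2
        (InnerProductSpace.isPositive_rankOne_self Ψ))
  rw [IsTraceClass, traceNorm, hp]
  have e : ∀ i, ENNReal.ofReal (⟪basisVec H i,
      (‖a‖ • InnerProductSpace.rankOne ℂ Ψ Ψ) (basisVec H i)⟫_ℂ).re =
      ENNReal.ofReal ‖a‖ * ‖⟪basisVec H i, Ψ⟫_ℂ‖ₑ ^ 2 := fun i => by
    rw [smul_apply, InnerProductSpace.rankOne_apply, inner_smul_right_eq_smul,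
      inner_smul_right, ← inner_conj_symm Ψ, ← Complex.normSq_eq_conj_mul_self, Complex.real_smul,
      ← Complex.ofReal_mul, Complex.ofReal_re, ENNReal.ofReal_mul (norm_nonneg _),
      Complex.normSq_eq_norm_sq, ENNReal.ofReal_pow (norm_nonneg _), ofReal_norm, ofReal_norm]
  rw [tsum_congr e, ENNReal.tsum_mul_left, tsum_enorm_inner_sq]
  exact ENNReal.mul_lt_top ENNReal.ofReal_lt_top (by finiteness)

theorem isState_proj (𝒜 : OStarAlgebra H) {Ψ : H} (h : Ψ ∈ 𝒜.domain) (hΨ : ‖Ψ‖ = 1) :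
    𝒜.IsState (proj Ψ) where
  pos := InnerProductSpace.isPositive_rankOne_self Ψ
  traceClass := isTraceClass_rankOne Ψ hΨ
  trace_eq_one := by
    have h2 : ⟪Ψ, Ψ⟫_ℂ = 1 := by rw [inner_self_eq_norm_sq_to_K, hΨ]; simp
    rw [trace, ← h2, ← (basisVec H).tsum_inner_mul_inner]
    refine tsum_congr fun i => ?_
    rw [proj, InnerProductSpace.rankOne_apply, inner_smul_right]
  mem_domain x := 𝒜.domain.smul_mem _ h
  traceClass_mul A _ := by
    refine ⟨InnerProductSpace.rankOne ℂ (A ⟨Ψ, h⟩ : H) Ψ, fun x => ?_, isTraceClass_rankOne _ hΨ⟩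
    have e : (⟨proj Ψ x, 𝒜.domain.smul_mem _ h⟩ : 𝒜.domain) = ⟪Ψ, x⟫_ℂ • ⟨Ψ, h⟩ := rfl
    rw [e, map_smul, InnerProductSpace.rankOne_apply, Submodule.coe_smul]

theorem conj_sub (V : H ≃ₗᵢ[ℂ] H) (S T : H →L[ℂ] H) : conj V (S - T) = conj V S - conj V T := by
  simp only [conj_eq_conjStarAlgEquiv, map_sub]

/-! ### Evolution of conditions -/

/-- If `V` commutes with `A` wherever both products are defined, the expectation values of `A` in
`ρ` and in `V ρ V*` agree. -/
theorem expect_conj (𝒜 : OStarAlgebra H) (V : H ≃ₗᵢ[ℂ] H) {A : Module.End ℂ 𝒜.domain}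
    (hA : A ∈ 𝒜.alg)
    (hV : ∀ x y : 𝒜.domain, (y : H) = V x → (A y : H) = V (A x)) {ρ : H →L[ℂ] H}
    (hρ : 𝒜.IsState ρ) (hρ' : 𝒜.IsState (conj V ρ)) :
    expect A (conj V ρ) = expect A ρ := by
  obtain ⟨T, hT, hTt⟩ := hρ.traceClass_mul A hA
  have e1 : expect A ρ = trace T := tsum_congr fun i => by
    rw [dif_pos (hρ.mem_domain _), hT]
  have e2 : expect A (conj V ρ) = trace (conj V T) := tsum_congr fun i => by
    rw [dif_pos (hρ'.mem_domain _), conj_apply V T, hT]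
    exact congrArg _ (hV ⟨ρ (V.symm (basisVec H i)), hρ.mem_domain _⟩ _ rfl)
  rw [e1, e2, trace_conj V hTt]

/-- A condition cut out of the smooth states by a predicate `p` evolves to the one cut out by `p'`
if unitary conjugation turns `p` into `p'`. -/
theorem evolvesTo_setOf (G : UnitaryGroup H) (𝒜 : OStarAlgebra H) (hG : ActsOnStates G 𝒜)
    (t₁ t₂ : ℝ) (p p' : (H →L[ℂ] H) → Prop)
    (h : ∀ ρ, 𝒜.IsState ρ → (p' (conj (G.U (t₂ - t₁)) ρ) ↔ p ρ)) :
    EvolvesTo G t₁ t₂ {ρ | 𝒜.IsState ρ ∧ p ρ} {ρ | 𝒜.IsState ρ ∧ p' ρ} := by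
  refine Set.Subset.antisymm ?_ fun ρ hρ => ?_
  · rintro _ ⟨ρ, hρ, rfl⟩
    exact ⟨hG _ _ hρ.1, (h ρ hρ.1).2 hρ.2⟩
  · have hs := hG (-(t₂ - t₁)) ρ hρ.1
    refine ⟨conj (G.U (-(t₂ - t₁))) ρ, ⟨hs, ?_⟩, G.conj_conj_neg _ _⟩
    rw [← h _ hs, G.conj_conj_neg]
    exact hρ.2

theorem evolvesTo_nu (G : UnitaryGroup H) (𝒜 : OStarAlgebra H) (hG : ActsOnStates G 𝒜)
    (t₁ t₂ δ : ℝ) (Ψ : H) :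
    EvolvesTo G t₁ t₂ (nu 𝒜 (proj Ψ) δ) (nu 𝒜 (proj (G.U (t₂ - t₁) Ψ)) δ) :=
  evolvesTo_setOf G 𝒜 hG t₁ t₂ _ _ fun ρ _ => by
    rw [← conj_proj, ← conj_sub, traceNorm_conj]

theorem evolvesTo_subNu (G : UnitaryGroup H) (𝒜 : OStarAlgebra H) (hG : ActsOnStates G 𝒜)
    (t₁ t₂ δ : ℝ) {Ψ : H} (h : Ψ ∈ 𝒜.domain) (hΨ : ‖Ψ‖ = 1) {A : Module.End ℂ 𝒜.domain}
    (hA : A ∈ 𝒜.alg)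
    (hV : ∀ x y : 𝒜.domain, (y : H) = G.U (t₂ - t₁) x → (A y : H) = G.U (t₂ - t₁) (A x)) :
    EvolvesTo G t₁ t₂ (subNu 𝒜 (proj Ψ) A δ) (subNu 𝒜 (proj (G.U (t₂ - t₁) Ψ)) A δ) :=
  evolvesTo_setOf G 𝒜 hG t₁ t₂ _ _ fun ρ hρ => by
    have hp := isState_proj 𝒜 h hΨ
    rw [← conj_proj, expect_conj 𝒜 _ hA hV hρ (hG _ _ hρ), expect_conj 𝒜 _ hA hV hp (hG _ _ hp)]

end Trace

/-! ### Tensor products of wave functions -/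

theorem enorm_sq_eq_lintegral {α : Type*} [MeasurableSpace α] {ν : Measure α} (f : Lp ℂ 2 ν) :
    ‖f‖ₑ ^ 2 = ∫⁻ x, ‖f x‖ₑ ^ 2 ∂ν := by
  have h := eLpNorm_nnreal_pow_eq_lintegral (f := f) (μ := ν) (p := 2) two_ne_zero
  rw [Lp.enorm_def]
  simpa using h

section Tensor

variable {d : ℕ} {X : Type*} [MeasurableSpace X] {μ : Measure X}

theorem coeFn_tensor (u : Lp ℂ 2 μ) (v : Lp ℂ 2 (volume : Measure (Sp d))) :
    ∀ᵐ z ∂(μ.prod (volume : Measure (Sp d))), tensor u v z = u z.1 * v z.2 :=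
  MemLp.coeFn_toLp _

theorem ae_fst {p : X → Prop} (h : ∀ᵐ x ∂μ, p x) :
    ∀ᵐ z ∂(μ.prod (volume : Measure (Sp d))), p z.1 :=
  Measure.quasiMeasurePreserving_fst.ae h

theorem ae_snd [SFinite μ] {p : Sp d → Prop} (h : ∀ᵐ y, p y) :
    ∀ᵐ z ∂(μ.prod (volume : Measure (Sp d))), p z.2 :=
  Measure.quasiMeasurePreserving_snd.ae h

theorem tensor_add_left (u w : Lp ℂ 2 μ) (v : Lp ℂ 2 (volume : Measure (Sp d))) :
    tensor (u + w) v = tensor u v + tensor w v := by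
  apply Lp.ext
  filter_upwards [coeFn_tensor (u + w) v, coeFn_tensor u v, coeFn_tensor w v,
    Lp.coeFn_add (tensor u v) (tensor w v), ae_fst (d := d) (Lp.coeFn_add u w)]
    with z h1 h2 h3 h4 h5
  rw [h1, h4, Pi.add_apply, h2, h3, h5, Pi.add_apply, add_mul]

theorem tensor_smul_left (c : ℂ) (u : Lp ℂ 2 μ) (v : Lp ℂ 2 (volume : Measure (Sp d))) :
    tensor (c • u) v = c • tensor u v := by
  apply Lp.ext
  filter_upwards [coeFn_tensor (c • u) v, coeFn_tensor u v,
    Lp.coeFn_smul c (tensor u v), ae_fst (d := d) (Lp.coeFn_smul c u)] with z h1 h2 h4 h5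
  rw [h1, h4, Pi.smul_apply, h2, h5, Pi.smul_apply, smul_eq_mul, smul_eq_mul, mul_assoc]

theorem inner_tensor_eq_integral (u : Lp ℂ 2 μ) (v : Lp ℂ 2 (volume : Measure (Sp d)))
    (Φ : Joint d μ) :
    ⟪tensor u v, Φ⟫_ℂ =
      ∫ z, (starRingEnd ℂ) (u z.1) * (starRingEnd ℂ) (v z.2) * Φ z ∂(μ.prod volume) := by
  rw [L2.inner_def]
  refine integral_congr_ae ?_
  filter_upwards [coeFn_tensor u v] with z hz
  rw [hz, RCLike.inner_apply, map_mul, mul_comm]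

theorem integrable_conj_tensor_mul (u : Lp ℂ 2 μ) (v : Lp ℂ 2 (volume : Measure (Sp d)))
    (Φ : Joint d μ) :
    Integrable (fun z => (starRingEnd ℂ) (u z.1) * (starRingEnd ℂ) (v z.2) * Φ z)
      (μ.prod volume) := by
  refine (L2.integrable_inner (𝕜 := ℂ) (tensor u v) Φ).congr ?_
  filter_upwards [coeFn_tensor u v] with z hz
  rw [hz, RCLike.inner_apply, map_mul, mul_comm]

/-- The norm of a wave function with slices `u(x) F(x)`. -/
theorem enorm_sq_eq_of_slice (u : Lp ℂ 2 μ) (Φ : Joint d μ)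
    (F : X → Lp ℂ 2 (volume : Measure (Sp d)))
    (hF : ∀ᵐ x ∂μ, ∀ᵐ y, Φ (x, y) = u x * F x y) :
    ‖Φ‖ₑ ^ 2 = ∫⁻ x, ‖u x‖ₑ ^ 2 * ‖F x‖ₑ ^ 2 ∂μ := by
  rw [enorm_sq_eq_lintegral Φ, lintegral_prod _ ((Lp.aestronglyMeasurable Φ).enorm.pow_const 2)]
  refine lintegral_congr_ae ?_
  filter_upwards [hF] with x hx
  rw [enorm_sq_eq_lintegral (F x),
    ← lintegral_const_mul'' _ ((Lp.aestronglyMeasurable (F x)).enorm.pow_const 2)]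
  refine lintegral_congr_ae ?_
  filter_upwards [hx] with y hy
  rw [hy, enorm_mul, mul_pow]

theorem norm_le_of_slice (u : Lp ℂ 2 μ) (Φ : Joint d μ) (F : X → Lp ℂ 2 (volume : Measure (Sp d)))
    (hF : ∀ᵐ x ∂μ, ∀ᵐ y, Φ (x, y) = u x * F x y) {c : ℝ} (hc0 : 0 ≤ c)
    (hc : ∀ᵐ x ∂μ, u x ≠ 0 → ‖F x‖ ≤ c) : ‖Φ‖ ≤ c * ‖u‖ := by
  have h : ‖Φ‖ₑ ^ 2 ≤ (ENNReal.ofReal c * ‖u‖ₑ) ^ 2 := by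
    rw [mul_pow, enorm_sq_eq_lintegral u, enorm_sq_eq_of_slice u Φ F hF,
      ← lintegral_const_mul'' _ ((Lp.aestronglyMeasurable u).enorm.pow_const 2)]
    refine lintegral_mono_ae ?_
    filter_upwards [hc] with x hcx
    rw [mul_comm]
    by_cases h0 : u x = 0
    · simp [h0]
    · gcongr
      rw [← ofReal_norm]
      exact ENNReal.ofReal_le_ofReal (hcx h0)
  have h' : ‖Φ‖ₑ ≤ ENNReal.ofReal c * ‖u‖ₑ := (ENNReal.pow_le_pow_left_iff two_ne_zero).1 h
  rw [← ofReal_norm, ← ofReal_norm, ← ENNReal.ofReal_mul hc0] at h'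
  exact (ENNReal.ofReal_le_ofReal_iff (by positivity)).1 h'

variable [SFinite μ]

theorem tensor_add_right (u : Lp ℂ 2 μ) (v w : Lp ℂ 2 (volume : Measure (Sp d))) :
    tensor u (v + w) = tensor u v + tensor u w := by
  apply Lp.ext
  filter_upwards [coeFn_tensor u (v + w), coeFn_tensor u v, coeFn_tensor u w,
    Lp.coeFn_add (tensor u v) (tensor u w), ae_snd (μ := μ) (Lp.coeFn_add v w)]
    with z h1 h2 h3 h4 h5
  rw [h1, h4, Pi.add_apply, h2, h3, h5, Pi.add_apply, mul_add]

theorem tensor_smul_right (c : ℂ) (u : Lp ℂ 2 μ) (v : Lp ℂ 2 (volume : Measure (Sp d))) :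
    tensor u (c • v) = c • tensor u v := by
  apply Lp.ext
  filter_upwards [coeFn_tensor u (c • v), coeFn_tensor u v,
    Lp.coeFn_smul c (tensor u v), ae_snd (μ := μ) (Lp.coeFn_smul c v)] with z h1 h2 h4 h5
  rw [h1, h4, Pi.smul_apply, h2, h5, Pi.smul_apply, smul_eq_mul, smul_eq_mul, mul_left_comm]

theorem inner_tensor (u u' : Lp ℂ 2 μ) (v v' : Lp ℂ 2 (volume : Measure (Sp d))) :
    ⟪tensor u v, tensor u' v'⟫_ℂ = ⟪u, u'⟫_ℂ * ⟪v, v'⟫_ℂ := by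
  rw [inner_tensor_eq_integral, L2.inner_def, L2.inner_def, ← integral_prod_mul]
  refine integral_congr_ae ?_
  filter_upwards [coeFn_tensor u' v'] with z hz
  rw [hz, RCLike.inner_apply, RCLike.inner_apply]
  ring

theorem norm_tensor (u : Lp ℂ 2 μ) (v : Lp ℂ 2 (volume : Measure (Sp d))) :
    ‖tensor u v‖ = ‖u‖ * ‖v‖ := by
  have h := inner_tensor u u v v
  simp only [inner_self_eq_norm_sq_to_K, ← mul_pow] at h
  exact (sq_eq_sq₀ (norm_nonneg _) (by positivity)).1 (by exact_mod_cast h)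

/-- The map `v ↦ u ⊗ v`. -/
def tensorRight (d : ℕ) (u : Lp ℂ 2 μ) : Lp ℂ 2 (volume : Measure (Sp d)) →L[ℂ] Joint d μ :=
  LinearMap.mkContinuous
    { toFun := tensor u
      map_add' := tensor_add_right u
      map_smul' := fun c v => tensor_smul_right c u v } ‖u‖ fun v => (norm_tensor u v).le

/-- The map `u ↦ u ⊗ v`. -/
def tensorLeft (μ : Measure X) [SFinite μ] (v : Lp ℂ 2 (volume : Measure (Sp d))) :
    Lp ℂ 2 μ →L[ℂ] Joint d μ :=
  LinearMap.mkContinuous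
    { toFun := fun u => tensor u v
      map_add' := fun u w => tensor_add_left u w v
      map_smul' := fun c u => tensor_smul_left c u v } ‖v‖
    fun u => by rw [mul_comm]; exact (norm_tensor u v).le

theorem tensorRight_apply (u : Lp ℂ 2 μ) (v : Lp ℂ 2 (volume : Measure (Sp d))) :
    tensorRight d u v = tensor u v := rfl

theorem tensorLeft_apply (u : Lp ℂ 2 μ) (v : Lp ℂ 2 (volume : Measure (Sp d))) :
    tensorLeft μ v u = tensor u v := rfl

theorem tensor_sum_left {ι : Type*} (s : Finset ι) (u : ι → Lp ℂ 2 μ)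
    (v : Lp ℂ 2 (volume : Measure (Sp d))) :
    tensor (∑ i ∈ s, u i) v = ∑ i ∈ s, tensor (u i) v :=
  map_sum (tensorLeft μ v) u s

/-- The partial inner product `Φ ↦ ∫ conj (u x) Φ(x, ·) dμ(x)`, as the adjoint of `v ↦ u ⊗ v`. -/
def contract (d : ℕ) (u : Lp ℂ 2 μ) : Joint d μ →L[ℂ] Lp ℂ 2 (volume : Measure (Sp d)) :=
  (tensorRight d u).adjoint

theorem norm_contract_le (u : Lp ℂ 2 μ) (Φ : Joint d μ) : ‖contract d u Φ‖ ≤ ‖u‖ * ‖Φ‖ := by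
  refine (contract d u).le_of_opNorm_le ?_ Φ
  rw [contract, ContinuousLinearMap.adjoint.norm_map]
  exact LinearMap.mkContinuous_norm_le _ (norm_nonneg _) _

theorem inner_contract (u : Lp ℂ 2 μ) (v : Lp ℂ 2 (volume : Measure (Sp d))) (Φ : Joint d μ) :
    ⟪v, contract d u Φ⟫_ℂ = ⟪tensor u v, Φ⟫_ℂ :=
  ContinuousLinearMap.adjoint_inner_right _ _ _

theorem contract_tensor (u u' : Lp ℂ 2 μ) (v : Lp ℂ 2 (volume : Measure (Sp d))) :
    contract d u (tensor u' v) = ⟪u, u'⟫_ℂ • v :=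
  ext_inner_left ℂ fun w => by rw [inner_contract, inner_tensor, inner_smul_right]

theorem contract_ae_eq [SigmaFinite μ] (u : Lp ℂ 2 μ) (Φ : Joint d μ) :
    ∀ᵐ y, contract d u Φ y = ∫ x, (starRingEnd ℂ) (u x) * Φ (x, y) ∂μ := by
  have key : ∀ s (hs : MeasurableSet s) (hμ : volume s < ∞),
      ∀ z : X × Sp d, (starRingEnd ℂ) (u z.1) * (starRingEnd ℂ) (s.indicator (fun _ => 1) z.2) * Φ z
        = s.indicator (fun y => (starRingEnd ℂ) (u z.1) * Φ (z.1, y)) z.2 := fun s _ _ z => by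
    by_cases hz : z.2 ∈ s <;> simp [hz]
  have hae : ∀ s (hs : MeasurableSet s) (hμ : volume s < ∞),
      (fun z : X × Sp d => (starRingEnd ℂ) (u z.1) * (starRingEnd ℂ)
        ((indicatorConstLp 2 hs hμ.ne (1 : ℂ) : Lp ℂ 2 (volume : Measure (Sp d))) z.2) * Φ z)
      =ᵐ[μ.prod volume]
      fun z => s.indicator (fun y => (starRingEnd ℂ) (u z.1) * Φ (z.1, y)) z.2 :=
    fun s hs hμ => by
      filter_upwards [ae_snd (μ := μ) (indicatorConstLp_coeFn (p := 2) (hs := hs) (hμs := hμ.ne)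
        (c := (1 : ℂ)))] with z hz
      rw [hz, key s hs hμ]
  have hint : ∀ s (hs : MeasurableSet s) (hμ : volume s < ∞),
      Integrable (fun z : X × Sp d =>
        s.indicator (fun y => (starRingEnd ℂ) (u z.1) * Φ (z.1, y)) z.2) (μ.prod volume) :=
    fun s hs hμ =>
      (integrable_conj_tensor_mul u (indicatorConstLp 2 hs hμ.ne 1) Φ).congr (hae s hs hμ)
  have hswap : ∀ (s : Set (Sp d)) y,
      ∫ x, s.indicator (fun y => (starRingEnd ℂ) (u x) * Φ (x, y)) y ∂μ
      = s.indicator (fun y => ∫ x, (starRingEnd ℂ) (u x) * Φ (x, y) ∂μ) y := fun s y => by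
    by_cases hy : y ∈ s <;> simp [hy]
  refine ae_eq_of_forall_setIntegral_eq_of_sigmaFinite (fun s hs hμ => ?_) (fun s hs hμ => ?_)
    fun s hs hμ => ?_
  · exact integrableOn_Lp_of_measure_ne_top _ (by norm_num) hμ.ne
  · rw [← integrable_indicator_iff hs]
    have h := (hint s hs hμ).integral_prod_right
    simpa only [hswap] using h
  · rw [← L2.inner_indicatorConstLp_one hs hμ.ne, inner_contract, inner_tensor_eq_integral,
      integral_congr_ae (hae s hs hμ), integral_prod_symm _ (hint s hs hμ), ← integral_indicator hs]
    simp only [hswap]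

end Tensor

/-! ### Density of product wave functions -/

section Density

variable {d : ℕ} {X : Type*} [MeasurableSpace X] {μ : Measure X}

/-- An integrable function on a product whose integrals over all rectangles vanish is zero. -/
theorem ae_eq_zero_of_forall_setIntegral_prod {α β : Type*} [MeasurableSpace α]
    [MeasurableSpace β] {ν : Measure (α × β)} {f : α × β → ℂ} (hf : Integrable f ν)
    (h : ∀ s t, MeasurableSet s → MeasurableSet t → ∫ z in s ×ˢ t, f z ∂ν = 0) : f =ᵐ[ν] 0 := by
  refine hf.ae_eq_zero_of_forall_setIntegral_eq_zero fun s hs hs' => ?_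
  clear hs'
  have huniv : ∫ z, f z ∂ν = 0 := by
    simpa using h Set.univ Set.univ MeasurableSet.univ MeasurableSet.univ
  induction s, hs using MeasurableSpace.induction_on_inter generateFrom_prod.symm
    isPiSystem_prod with
  | empty => simp
  | basic t ht =>
    obtain ⟨a, ha, b, hb, rfl⟩ := ht
    exact h a b ha hb
  | compl t htm ih => rw [setIntegral_compl htm hf, huniv, ih, sub_zero]
  | iUnion g hd hm ih =>
    rw [integral_iUnion hm hd hf.integrableOn, tsum_congr ih, tsum_zero]

/-- The function `1_A` is in the domain of the measurand if `q` is bounded on `A`. -/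
theorem indicator_mem_domain {q : X → Sp d} (hq : Measurable q) {A : Set X} (hA : MeasurableSet A)
    (hμ : μ A ≠ ∞) {n : ℝ} (hn : ∀ x ∈ A, ‖q x‖ ≤ n) (j : Fin d) :
    indicatorConstLp 2 hA hμ (1 : ℂ) ∈ (multOp μ fun x => q x j).domain := by
  have hm : Measurable fun x => q x j := by fun_prop
  refine MemLp.of_le_mul (c := n) (Lp.memLp (indicatorConstLp 2 hA hμ (1 : ℂ)))
    (hm.complex_ofReal.aestronglyMeasurable.mul (Lp.aestronglyMeasurable _)) ?_
  filter_upwards [indicatorConstLp_coeFn (p := 2) (hs := hA) (hμs := hμ) (c := (1 : ℂ))] with x hx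
  rw [hx]
  by_cases h : x ∈ A
  · simp only [h, Set.indicator_of_mem, mul_one, norm_one, Complex.norm_real]
    exact (PiLp.norm_apply_le (q x) j).trans (hn x h)
  · simp [h]

/-- The vectors `1_A ⊗ f`, with `q` bounded on `A` and `f` a Schwartz function, are total. -/
theorem eq_zero_of_inner_tensor [SigmaFinite μ] {q : X → Sp d} (hq : Measurable q) (Φ : Joint d μ)
    (h : ∀ (A : Set X) (hA : MeasurableSet A) (hμ : μ A ≠ ∞) (n : ℕ), (∀ x ∈ A, ‖q x‖ ≤ n) →
      ∀ f : 𝓢(Sp d, ℂ), ⟪tensor (indicatorConstLp 2 hA hμ (1 : ℂ)) (f.toLp 2), Φ⟫_ℂ = 0) :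
    Φ = 0 := by
  have hv : ∀ (A : Set X) (hA : MeasurableSet A) (hμ : μ A ≠ ∞) (n : ℕ), (∀ x ∈ A, ‖q x‖ ≤ n) →
      ∀ v, ⟪tensor (indicatorConstLp 2 hA hμ (1 : ℂ)) v, Φ⟫_ℂ = 0 := by
    intro A hA hμ n hn v
    have hd : DenseRange (SchwartzMap.toLpCLM ℝ ℂ 2 (volume : Measure (Sp d))) :=
      SchwartzMap.denseRange_toLpCLM (p := 2) (by norm_num)
    refine hd.induction_on (p := fun v => ⟪tensor (indicatorConstLp 2 hA hμ (1 : ℂ)) v, Φ⟫_ℂ = 0)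
      v ?_ fun f => h A hA hμ n hn f
    exact isClosed_eq (((tensorRight d _).continuous).inner continuous_const) continuous_const
  let R : ℕ → Set X := fun n => spanningSets μ n ∩ {x | ‖q x‖ ≤ n}
  let S : ℕ → Set (Sp d) := spanningSets volume
  have hR : ∀ n, MeasurableSet (R n) := fun n =>
    (measurableSet_spanningSets μ n).inter (hq.norm measurableSet_Iic)
  have hRf : ∀ n, μ (R n) ≠ ∞ := fun n =>
    (measure_mono Set.inter_subset_left).trans_lt (measure_spanningSets_lt_top μ n) |>.ne
  have hSf : ∀ n, volume (S n) ≠ ∞ := fun n => (measure_spanningSets_lt_top volume n).ne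
  have hRS : ∀ n, (μ.prod (volume : Measure (Sp d))) (R n ×ˢ S n) ≠ ∞ := fun n => by
    rw [Measure.prod_prod]
    exact ENNReal.mul_ne_top (hRf n) (hSf n)
  have hmS : ∀ n, MeasurableSet (S n) := measurableSet_spanningSets volume
  have key : ∀ n, ∀ᵐ z ∂(μ.prod (volume : Measure (Sp d))), z ∈ R n ×ˢ S n → Φ z = 0 := by
    intro n
    rw [← ae_restrict_iff' ((hR n).prod (hmS n))]
    refine ae_eq_zero_of_forall_setIntegral_prod
      (integrableOn_Lp_of_measure_ne_top Φ (by norm_num) (hRS n)) fun a b ha hb => ?_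
    rw [Measure.restrict_restrict (ha.prod hb), Set.prod_inter_prod]
    have hA := ha.inter (hR n)
    have hB := hb.inter (hmS n)
    have hAf : μ (a ∩ R n) ≠ ∞ := ne_top_of_le_ne_top (hRf n) (measure_mono Set.inter_subset_right)
    have hBf : volume (b ∩ S n) ≠ ∞ :=
      ne_top_of_le_ne_top (hSf n) (measure_mono Set.inter_subset_right)
    rw [← hv _ hA hAf n (fun x hx => hx.2.2) (indicatorConstLp 2 hB hBf 1),
      inner_tensor_eq_integral, ← integral_indicator (hA.prod hB)]
    refine integral_congr_ae ?_
    filter_upwards [ae_snd (μ := μ) (indicatorConstLp_coeFn (p := 2) (hs := hB) (hμs := hBf)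
        (c := (1 : ℂ))), ae_fst (d := d) (indicatorConstLp_coeFn (p := 2) (hs := hA) (hμs := hAf)
        (c := (1 : ℂ)))] with z h1 h2
    rw [h1, h2]
    by_cases hz1 : z.1 ∈ a ∩ R n <;> by_cases hz2 : z.2 ∈ b ∩ S n <;>
      simp [Set.indicator, hz1, hz2, Set.mem_prod, -Set.mem_inter_iff]
  apply Lp.ext
  filter_upwards [ae_all_iff.2 key, Lp.coeFn_zero ℂ 2 (μ.prod (volume : Measure (Sp d)))]
    with z hz h0
  rw [h0]
  obtain ⟨n, hn⟩ := exists_nat_ge ‖q z.1‖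
  have hx : ∀ m, spanningSetsIndex μ z.1 ≤ m → z.1 ∈ spanningSets μ m := fun m hm =>
    monotone_spanningSets μ hm (mem_spanningSetsIndex μ z.1)
  have hy : ∀ m, spanningSetsIndex volume z.2 ≤ m → z.2 ∈ spanningSets volume m := fun m hm =>
    monotone_spanningSets volume hm (mem_spanningSetsIndex volume z.2)
  let m := max n (max (spanningSetsIndex μ z.1) (spanningSetsIndex volume z.2))
  refine hz m ⟨⟨hx m (by simp [m]), ?_⟩, hy m (by simp [m])⟩
  exact hn.trans (by simp [m])

/-- Two bounded operators that agree on the vectors `1_A ⊗ f` are equal. -/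
theorem eq_of_eq_tensor [SigmaFinite μ] {q : X → Sp d} (hq : Measurable q)
    (V W : Joint d μ →L[ℂ] Joint d μ)
    (h : ∀ (A : Set X) (hA : MeasurableSet A) (hμ : μ A ≠ ∞) (n : ℕ), (∀ x ∈ A, ‖q x‖ ≤ n) →
      ∀ f : 𝓢(Sp d, ℂ), V (tensor (indicatorConstLp 2 hA hμ (1 : ℂ)) (f.toLp 2)) =
        W (tensor (indicatorConstLp 2 hA hμ (1 : ℂ)) (f.toLp 2))) : V = W := by
  have h0 : ∀ Φ, (V - W).adjoint Φ = 0 := fun Φ =>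
    eq_zero_of_inner_tensor hq _ fun A hA hμ n hn f => by
      rw [ContinuousLinearMap.adjoint_inner_right, sub_apply, h A hA hμ n hn f,
        sub_self, inner_zero_left]
  have h1 : (V - W).adjoint = 0 := ContinuousLinearMap.ext h0
  rw [← sub_eq_zero, ← ContinuousLinearMap.adjoint_adjoint (V - W), h1, map_zero]

end Density

/-! ### Translations and shears -/

section Shear

variable {d : ℕ} {X : Type*} [MeasurableSpace X] {μ : Measure X}

/-- The translation `(T_b φ)(y) = φ(y + b)`. -/
def translate (b : Sp d) :
    Lp ℂ 2 (volume : Measure (Sp d)) →ₗᵢ[ℂ] Lp ℂ 2 (volume : Measure (Sp d)) :=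
  Lp.compMeasurePreservingₗᵢ ℂ (fun y => y + b) (measurePreserving_add_right volume b)

theorem translate_ae_eq (b : Sp d) (φ : Lp ℂ 2 (volume : Measure (Sp d))) :
    ∀ᵐ y, translate b φ y = φ (y + b) :=
  Lp.coeFn_compMeasurePreserving φ (measurePreserving_add_right volume b)

theorem translate_zero (φ : Lp ℂ 2 (volume : Measure (Sp d))) : translate 0 φ = φ := by
  apply Lp.ext
  filter_upwards [translate_ae_eq 0 φ] with y hy
  rw [hy, add_zero]

theorem continuous_translate (φ : Lp ℂ 2 (volume : Measure (Sp d))) :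
    Continuous fun b => translate b φ := by
  have hg : Continuous fun b : Sp d => (⟨fun y => y + b, by fun_prop⟩ : C(Sp d, Sp d)) :=
    ContinuousMap.continuous_of_continuous_uncurry _
      (continuous_snd.add continuous_fst)
  exact Continuous.compMeasurePreservingLp (f := fun _ : Sp d => φ) (p := 2) continuous_const hg
    (fun b => measurePreserving_add_right volume b) (by norm_num)

theorem measurePreserving_shear [SFinite μ] {q : X → Sp d} (hq : Measurable q) (s : ℝ) :
    MeasurePreserving (fun z : X × Sp d => (z.1, z.2 + s • q z.1)) (μ.prod volume)
      (μ.prod volume) :=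
  (MeasurePreserving.id μ).skew_product (g := fun x y => y + s • q x) (by fun_prop)
    (Filter.Eventually.of_forall fun x => (measurePreserving_add_right volume (s • q x)).map_eq)

variable [SFinite μ]

/-- The isometry `Φ(x, y) ↦ Φ(x, y + s q(x))`. -/
def shearIsometry (μ : Measure X) [SFinite μ] {q : X → Sp d} (hq : Measurable q) (s : ℝ) :
    Joint d μ →ₗᵢ[ℂ] Joint d μ :=
  Lp.compMeasurePreservingₗᵢ ℂ _ (measurePreserving_shear hq s)

theorem shearIsometry_ae_eq {q : X → Sp d} (hq : Measurable q) (s : ℝ) (Φ : Joint d μ) :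
    ∀ᵐ z ∂(μ.prod volume), shearIsometry μ hq s Φ z = Φ (z.1, z.2 + s • q z.1) :=
  Lp.coeFn_compMeasurePreserving Φ (measurePreserving_shear hq s)

theorem shearIsometry_add {q : X → Sp d} (hq : Measurable q) (s t : ℝ) (Φ : Joint d μ) :
    shearIsometry μ hq (s + t) Φ = shearIsometry μ hq s (shearIsometry μ hq t Φ) := by
  apply Lp.ext
  filter_upwards [shearIsometry_ae_eq hq (s + t) Φ, shearIsometry_ae_eq hq s
    (shearIsometry μ hq t Φ), (measurePreserving_shear hq s).quasiMeasurePreserving.ae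
    (shearIsometry_ae_eq hq t Φ)] with z h1 h2 h3
  rw [h1, h2, h3, add_smul, add_assoc]

theorem shearIsometry_zero {q : X → Sp d} (hq : Measurable q) (Φ : Joint d μ) :
    shearIsometry μ hq 0 Φ = Φ := by
  apply Lp.ext
  filter_upwards [shearIsometry_ae_eq hq 0 Φ] with z h1
  rw [h1, zero_smul, add_zero]

/-- The unitary operator `Φ(x, y) ↦ Φ(x, y + s q(x))`. -/
def shear (μ : Measure X) [SFinite μ] {q : X → Sp d} (hq : Measurable q) (s : ℝ) :
    Joint d μ ≃ₗᵢ[ℂ] Joint d μ where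
  toLinearEquiv := LinearEquiv.ofLinearMap (shearIsometry μ hq s).toLinearMap
    (shearIsometry μ hq (-s)).toLinearMap
    (LinearMap.ext fun Φ => by
      change shearIsometry μ hq s (shearIsometry μ hq (-s) Φ) = Φ
      rw [← shearIsometry_add, add_neg_cancel, shearIsometry_zero])
    (LinearMap.ext fun Φ => by
      change shearIsometry μ hq (-s) (shearIsometry μ hq s Φ) = Φ
      rw [← shearIsometry_add, neg_add_cancel, shearIsometry_zero])
  norm_map' Φ := (shearIsometry μ hq s).norm_map Φ

theorem shear_ae_eq {q : X → Sp d} (hq : Measurable q) (s : ℝ) (Φ : Joint d μ) :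
    ∀ᵐ z ∂(μ.prod volume), shear μ hq s Φ z = Φ (z.1, z.2 + s • q z.1) :=
  shearIsometry_ae_eq hq s Φ

theorem shear_add {q : X → Sp d} (hq : Measurable q) (s t : ℝ) (Φ : Joint d μ) :
    shear μ hq (s + t) Φ = shear μ hq s (shear μ hq t Φ) :=
  shearIsometry_add hq s t Φ

theorem shear_zero {q : X → Sp d} (hq : Measurable q) (Φ : Joint d μ) :
    shear μ hq 0 Φ = Φ :=
  shearIsometry_zero hq Φ

/-- On a product wave function the shear translates each slice. -/
theorem shear_tensor_ae_eq {q : X → Sp d} (hq : Measurable q) (s : ℝ) (u : Lp ℂ 2 μ)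
    (v : Lp ℂ 2 (volume : Measure (Sp d))) :
    ∀ᵐ z ∂(μ.prod volume), shear μ hq s (tensor u v) z = u z.1 * v (z.2 + s • q z.1) := by
  filter_upwards [shear_ae_eq hq s (tensor u v),
    (measurePreserving_shear hq s).quasiMeasurePreserving.ae (coeFn_tensor u v)] with z h1 h2
  rw [h1, h2]

/-- If the measurand has the value `l` wherever `u ≠ 0`, the shear acts as a translation. -/
theorem shear_tensor_of_eq {q : X → Sp d} (hq : Measurable q) (s : ℝ) {u : Lp ℂ 2 μ} {l : Sp d}
    (h : ∀ᵐ x ∂μ, u x ≠ 0 → q x = l) (v : Lp ℂ 2 (volume : Measure (Sp d))) :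
    shear μ hq s (tensor u v) = tensor u (translate (s • l) v) := by
  apply Lp.ext
  filter_upwards [shear_tensor_ae_eq hq s u v, coeFn_tensor u (translate (s • l) v),
    ae_fst (d := d) h, ae_snd (μ := μ) (translate_ae_eq (s • l) v)] with z h1 h2 h3 h4
  rw [h1, h2, h4]
  by_cases hz : u z.1 = 0
  · rw [hz, zero_mul, zero_mul]
  · rw [h3 hz]

end Shear

/-! ### The generator of the shear group -/

section Generator

variable {d : ℕ} {X : Type*} [MeasurableSpace X] {μ : Measure X}

/-- The partial derivative `∂_j f`. -/
def pderiv (j : Fin d) (f : 𝓢(Sp d, ℂ)) : 𝓢(Sp d, ℂ) := ∂_{dir j} f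

/-- The first order Taylor remainder of a Schwartz function is rapidly decreasing, uniformly for
increments `b` with `‖b‖ ≤ 1`, and quadratic in `b`. -/
theorem schwartz_taylor_bound (f : 𝓢(Sp d, ℂ)) (n : ℕ) :
    ∃ K : ℝ, 0 ≤ K ∧ ∀ b : Sp d, ‖b‖ ≤ 1 → ∀ y,
      ‖f (y + b) - f y - fderiv ℝ f y b‖ ≤ ‖b‖ ^ 2 * (K * ((1 + ‖y‖) ^ n)⁻¹) := by
  let F := SchwartzMap.fderivCLM ℝ (Sp d) ℂ f
  let F' := SchwartzMap.fderivCLM ℝ (Sp d) (Sp d →L[ℝ] ℂ) F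
  have hf : ∀ z, HasFDerivAt f (F z) z := fun z => f.hasFDerivAt z
  have hF : ∀ z, HasFDerivAt F (F' z) z := fun z => F.hasFDerivAt z
  obtain ⟨M, hM⟩ : ∃ M : ℝ, ∀ z, (1 + ‖z‖) ^ n * ‖F' z‖ ≤ M :=
    ⟨_, fun z => by
      simpa only [norm_iteratedFDeriv_zero] using
        SchwartzMap.one_add_le_sup_seminorm_apply (𝕜 := ℝ) (m := (n, 0)) (k := n) (n := 0)
          le_rfl le_rfl F' z⟩
  have hM0 : 0 ≤ M := (by positivity : (0 : ℝ) ≤ (1 + ‖(0 : Sp d)‖) ^ n * ‖F' 0‖).trans (hM 0)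
  refine ⟨2 ^ n * M, by positivity, fun b hb y => ?_⟩
  have hyp : 0 < 1 + ‖y‖ := by positivity
  set C : ℝ := 2 ^ n * M * ((1 + ‖y‖) ^ n)⁻¹ with hC
  have hC0 : 0 ≤ C := by positivity
  have hball : ∀ z ∈ Metric.closedBall y ‖b‖, ‖F' z‖ ≤ C := fun z hz => by
    have h1 : ‖z - y‖ ≤ 1 := (mem_closedBall_iff_norm.1 hz).trans hb
    have h2 : 1 + ‖y‖ ≤ 2 * (1 + ‖z‖) := by
      have := norm_sub_norm_le y z
      rw [norm_sub_rev] at this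
      linarith [norm_nonneg z]
    have h3 : (1 + ‖y‖) ^ n * ‖F' z‖ ≤ 2 ^ n * M := by
      calc (1 + ‖y‖) ^ n * ‖F' z‖ ≤ (2 * (1 + ‖z‖)) ^ n * ‖F' z‖ := by gcongr
        _ = 2 ^ n * ((1 + ‖z‖) ^ n * ‖F' z‖) := by rw [mul_pow, mul_assoc]
        _ ≤ 2 ^ n * M := by gcongr; exact hM z
    rw [hC, ← div_eq_mul_inv, le_div_iff₀ (by positivity), mul_comm]
    exact h3
  have hy : y ∈ Metric.closedBall y ‖b‖ := Metric.mem_closedBall_self (norm_nonneg _)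
  have hyb : y + b ∈ Metric.closedBall y ‖b‖ := by simp
  have hconv := convex_closedBall (E := Sp d) y ‖b‖
  have step1 : ∀ z ∈ Metric.closedBall y ‖b‖, ‖F z - F y‖ ≤ C * ‖b‖ := fun z hz =>
    (hconv.norm_image_sub_le_of_norm_hasFDerivWithin_le (𝕜 := ℝ)
      (fun w _ => (hF w).hasFDerivWithinAt) hball hy hz).trans
      (mul_le_mul_of_nonneg_left (mem_closedBall_iff_norm.1 hz) hC0)
  have step2 := hconv.norm_image_sub_le_of_norm_hasFDerivWithin_le (𝕜 := ℝ)
      (f := fun z => f z - F y z) (f' := fun z => F z - F y)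
      (fun w _ => ((hf w).sub (F y).hasFDerivAt).hasFDerivWithinAt) step1 hy hyb
  have e : f (y + b) - F y (y + b) - (f y - F y y) = f (y + b) - f y - fderiv ℝ f y b := by
    change f (y + b) - F y (y + b) - (f y - F y y) = f (y + b) - f y - F y b
    rw [(F y).map_add]
    ring
  rw [e, add_sub_cancel_left] at step2
  linarith

/-- The first order Taylor remainder `T_b f - f - ∑ j, b_j ∂_j f` of a translation. -/
def translateRemainder (f : 𝓢(Sp d, ℂ)) (b : Sp d) : Lp ℂ 2 (volume : Measure (Sp d)) :=
  translate b (f.toLp 2 volume) - f.toLp 2 volume - ∑ j, (b j : ℂ) • (pderiv j f).toLp 2 volume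

theorem coeFn_finset_sum {α ι : Type*} [MeasurableSpace α] {ν : Measure α} (s : Finset ι)
    (F : ι → Lp ℂ 2 ν) : ∀ᵐ x ∂ν, (∑ i ∈ s, F i) x = ∑ i ∈ s, F i x := by
  classical
  induction s using Finset.induction_on with
  | empty =>
    filter_upwards [Lp.coeFn_zero ℂ 2 ν] with x hx
    simpa using hx
  | insert a s ha ih =>
    rw [Finset.sum_insert ha]
    filter_upwards [ih, Lp.coeFn_add (F a) (∑ i ∈ s, F i)] with x h1 h2
    rw [h2, Pi.add_apply, h1, Finset.sum_insert ha]

theorem coeFn_translate_toLp (f : 𝓢(Sp d, ℂ)) (b : Sp d) :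
    ∀ᵐ y, translate b (f.toLp 2 volume) y = f (y + b) := by
  filter_upwards [translate_ae_eq b (f.toLp 2 volume),
    (measurePreserving_add_right volume b).quasiMeasurePreserving.ae (f.coeFn_toLp 2 volume)]
    with y h1 h2
  rw [h1, h2]

theorem translateRemainder_ae_eq (f : 𝓢(Sp d, ℂ)) (b : Sp d) :
    ∀ᵐ y, translateRemainder f b y = f (y + b) - f y - ∑ j, (b j : ℂ) * pderiv j f y := by
  have h6 : ∀ᵐ y, ∀ j, ((b j : ℂ) • (pderiv j f).toLp 2 volume : Lp ℂ 2 (volume : Measure (Sp d))) y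
      = (b j : ℂ) * pderiv j f y := ae_all_iff.2 fun j => by
    filter_upwards [Lp.coeFn_smul (b j : ℂ) ((pderiv j f).toLp 2 volume),
      (pderiv j f).coeFn_toLp 2 volume] with y h1 h2
    rw [h1, Pi.smul_apply, h2, smul_eq_mul]
  filter_upwards [Lp.coeFn_sub (translate b (f.toLp 2 volume) - f.toLp 2 volume)
      (∑ j, (b j : ℂ) • (pderiv j f).toLp 2 volume),
    Lp.coeFn_sub (translate b (f.toLp 2 volume)) (f.toLp 2 volume),
    coeFn_translate_toLp f b, f.coeFn_toLp 2 volume,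
    coeFn_finset_sum Finset.univ (fun j => (b j : ℂ) • (pderiv j f).toLp 2 volume), h6]
    with y h1 h2 h3 h4 h5 h6
  rw [translateRemainder, h1, Pi.sub_apply, h2, Pi.sub_apply, h3, h4, h5,
    Finset.sum_congr rfl fun j _ => h6 j]

theorem sum_mul_lineDeriv (f : 𝓢(Sp d, ℂ)) (b y : Sp d) :
    ∑ j, (b j : ℂ) * pderiv j f y = fderiv ℝ f y b := by
  have hb : b = ∑ j, b j • dir j := by
    conv_lhs => rw [← (EuclideanSpace.basisFun (Fin d) ℝ).sum_repr b]
    simp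
  conv_rhs => rw [hb]
  rw [map_sum]
  refine Finset.sum_congr rfl fun j _ => ?_
  rw [map_smul, pderiv, SchwartzMap.lineDerivOp_apply_eq_fderiv, Complex.real_smul]

/-- The remainder is quadratic for small `b`, by Taylor's formula, and grows linearly for large `b`,
as translations are isometries. -/
theorem norm_translateRemainder_le (f : 𝓢(Sp d, ℂ)) :
    ∃ C : ℝ, 0 ≤ C ∧ ∀ b, ‖translateRemainder f b‖ ≤ C * min ‖b‖ (‖b‖ ^ 2) := by
  obtain ⟨K, hK0, hK⟩ := schwartz_taylor_bound f (d + 1)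
  have hm : MemLp (fun y : Sp d => K * ((1 + ‖y‖) ^ (d + 1))⁻¹) 2 volume := by
    refine MemLp.const_mul ?_ K
    refine (memLp_two_iff_integrable_sq_norm (by fun_prop)).2 ?_
    have h := integrable_one_add_norm (E := Sp d) (μ := volume) (r := ((2 * (d + 1) : ℕ) : ℝ))
      (by rw [finrank_euclideanSpace_fin]; push_cast; linarith)
    refine h.congr (Filter.Eventually.of_forall fun y => ?_)
    have : 0 ≤ 1 + ‖y‖ := by positivity
    simp only [norm_inv, norm_pow, Real.norm_eq_abs, abs_of_nonneg this]
    rw [Real.rpow_neg this, Real.rpow_natCast, inv_pow, ← pow_mul, mul_comm 2]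
  let g : Lp ℝ 2 (volume : Measure (Sp d)) := hm.toLp
  let B : ℝ := 2 * ‖f.toLp 2 volume‖ +
    ∑ j, ‖(pderiv j f).toLp 2 volume‖
  have hB0 : 0 ≤ B := by positivity
  refine ⟨‖g‖ + B, by positivity, fun b => ?_⟩
  rcases le_total ‖b‖ 1 with hb | hb
  · have hle : ‖b‖ ^ 2 ≤ ‖b‖ := by nlinarith [norm_nonneg b]
    rw [min_eq_right hle]
    have h : ‖translateRemainder f b‖ ≤ ‖b‖ ^ 2 * ‖g‖ := by
      refine Lp.norm_le_mul_norm_of_ae_le_mul ?_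
      filter_upwards [translateRemainder_ae_eq f b, hm.coeFn_toLp] with y h1 h2
      rw [h1, sum_mul_lineDeriv]
      refine (hK b hb y).trans ?_
      rw [h2, Real.norm_of_nonneg (by positivity)]
    nlinarith [sq_nonneg ‖b‖, norm_nonneg g]
  · have hle : ‖b‖ ≤ ‖b‖ ^ 2 := by nlinarith
    rw [min_eq_left hle]
    have h : ‖translateRemainder f b‖ ≤ ‖f.toLp 2 volume‖ +
        ‖f.toLp 2 volume‖ +
        ∑ j, ‖b‖ * ‖(pderiv j f).toLp 2 volume‖ := by
      refine (norm_sub_le _ _).trans (add_le_add ((norm_sub_le _ _).trans ?_)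
        ((norm_sum_le _ _).trans (Finset.sum_le_sum fun j _ => ?_)))
      · rw [(translate b).norm_map]
      · rw [norm_smul, Complex.norm_real]
        gcongr
        exact PiLp.norm_apply_le b j
    rw [← Finset.mul_sum] at h
    have hs : 0 ≤ ∑ j, ‖(pderiv j f).toLp 2 volume‖ := by positivity
    have : ‖translateRemainder f b‖ ≤ ‖b‖ * B := by
      simp only [B]
      nlinarith [norm_nonneg (f.toLp 2 volume)]
    nlinarith [norm_nonneg g]

theorem multOp_ae_eq {Y : Type*} [MeasurableSpace Y] {ν : Measure Y} {g : Y → ℝ}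
    (u : (multOp ν g).domain) :
    ∀ᵐ y ∂ν, multOp ν g u y = (g y : ℂ) * u.1 y :=
  MemLp.coeFn_toLp (u.2 : MemLp (fun y => (g y : ℂ) * u.1 y) 2 ν)

/-- The vector `∑ j, q_j u ⊗ ∂_j f`, the value at `u ⊗ f` of the generator of the shears by
`s q`. -/
def generatorVec {q : X → Sp d} (u : Lp ℂ 2 μ)
    (hu : ∀ j, u ∈ (multOp μ fun x => q x j).domain) (f : 𝓢(Sp d, ℂ)) : Joint d μ :=
  ∑ j, tensor (multOp μ (fun x => q x j) ⟨u, hu j⟩) ((pderiv j f).toLp 2 volume)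

theorem generatorVec_ae_eq [SFinite μ] {q : X → Sp d} (u : Lp ℂ 2 μ)
    (hu : ∀ j, u ∈ (multOp μ fun x => q x j).domain) (f : 𝓢(Sp d, ℂ)) :
    ∀ᵐ z ∂(μ.prod volume), generatorVec u hu f z =
      u z.1 * ∑ j, (q z.1 j : ℂ) * pderiv j f z.2 := by
  have h : ∀ᵐ z ∂(μ.prod (volume : Measure (Sp d))), ∀ j,
      tensor (multOp μ (fun x => q x j) ⟨u, hu j⟩) ((pderiv j f).toLp 2 volume) z =
      u z.1 * ((q z.1 j : ℂ) * pderiv j f z.2) := ae_all_iff.2 fun j => by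
    filter_upwards [coeFn_tensor (multOp μ (fun x => q x j) ⟨u, hu j⟩) ((pderiv j f).toLp 2 volume),
      ae_fst (d := d) (multOp_ae_eq (⟨u, hu j⟩ : (multOp μ fun x => q x j).domain)),
      ae_snd (μ := μ) ((pderiv j f).coeFn_toLp 2 volume)] with z h1 h2 h3
    rw [h1, h2, h3]
    ring
  filter_upwards [coeFn_finset_sum Finset.univ fun j =>
    tensor (multOp μ (fun x => q x j) ⟨u, hu j⟩) ((pderiv j f).toLp 2 volume), h] with z h1 h2
  rw [generatorVec, h1, Finset.mul_sum, Finset.sum_congr rfl fun j _ => h2 j]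

/-- If `u` is in the domain of every component of the measurand, `‖q‖ u` is square integrable. -/
theorem lintegral_mul_norm_sq_ne_top {q : X → Sp d} (hq : Measurable q) (u : Lp ℂ 2 μ)
    (hu : ∀ j, u ∈ (multOp μ fun x => q x j).domain) (C : ℝ) :
    ∫⁻ x, ‖u x‖ₑ ^ 2 * ENNReal.ofReal (C * ‖q x‖) ^ 2 ∂μ ≠ ∞ := by
  have h1 : MemLp (fun x => ∑ j, ‖(q x j : ℂ) * u x‖) 2 μ :=
    memLp_finsetSum _ fun j _ => (hu j : MemLp (fun x => (q x j : ℂ) * u x) 2 μ).norm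
  have h2 : MemLp (fun x => ((C * ‖q x‖ : ℝ) : ℂ) * u x) 2 μ := by
    have hm : Measurable fun x => C * ‖q x‖ := by fun_prop
    refine MemLp.of_le_mul (c := |C|) h1
      (hm.complex_ofReal.aestronglyMeasurable.mul (Lp.aestronglyMeasurable _))
      (Filter.Eventually.of_forall fun x => ?_)
    have h3 : ‖q x‖ ≤ ∑ j, ‖q x j‖ := by
      conv_lhs => rw [← (EuclideanSpace.basisFun (Fin d) ℝ).sum_repr (q x)]
      refine (norm_sum_le _ _).trans (Finset.sum_le_sum fun j _ => ?_)
      simp [norm_smul]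
    simp only [norm_mul, Complex.norm_real, norm_norm]
    rw [← Finset.sum_mul, Real.norm_of_nonneg
      (mul_nonneg (Finset.sum_nonneg fun j _ => norm_nonneg _) (norm_nonneg _)), mul_assoc,
      Real.norm_eq_abs C]
    gcongr
  have h3 := enorm_sq_eq_lintegral h2.toLp
  have h4 : ‖h2.toLp‖ₑ ^ 2 ≠ ∞ := by finiteness
  rw [h3, lintegral_congr_ae (g := fun x => ‖((C * ‖q x‖ : ℝ) : ℂ) * u x‖ₑ ^ 2) (by
    filter_upwards [h2.coeFn_toLp] with x hx
    rw [hx])] at h4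
  refine ne_top_of_le_ne_top h4 (lintegral_mono fun x => ?_)
  rw [enorm_mul, mul_pow, mul_comm]
  gcongr
  rw [← ofReal_norm, Complex.norm_real]
  exact ENNReal.ofReal_le_ofReal (le_abs_self _)

/-- The shear group has the expected derivative on the vectors `u ⊗ f`. -/
theorem hasDerivAt_shear [SFinite μ] {q : X → Sp d} (hq : Measurable q) (u : Lp ℂ 2 μ)
    (hu : ∀ j, u ∈ (multOp μ fun x => q x j).domain) (f : 𝓢(Sp d, ℂ)) :
    HasDerivAt (fun s => shear μ hq s (tensor u (f.toLp 2 volume))) (generatorVec u hu f) 0 := by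
  obtain ⟨C, hC0, hC⟩ := norm_translateRemainder_le f
  have hslice : ∀ s : ℝ, ∀ᵐ x ∂μ, ∀ᵐ y,
      (shear μ hq s (tensor u (f.toLp 2 volume)) - tensor u (f.toLp 2 volume) -
        (s : ℂ) • generatorVec u hu f : Joint d μ) (x, y) =
      u x * translateRemainder f (s • q x) y := by
    intro s
    have h : ∀ᵐ z ∂(μ.prod (volume : Measure (Sp d))),
        (shear μ hq s (tensor u (f.toLp 2 volume)) - tensor u (f.toLp 2 volume) -
          (s : ℂ) • generatorVec u hu f : Joint d μ) z =
        u z.1 * (f (z.2 + s • q z.1) - f z.2 -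
          ∑ j, ((s • q z.1) j : ℂ) * pderiv j f z.2) := by
      filter_upwards [Lp.coeFn_sub
          (shear μ hq s (tensor u (f.toLp 2 volume)) - tensor u (f.toLp 2 volume))
          ((s : ℂ) • generatorVec u hu f),
        Lp.coeFn_sub (shear μ hq s (tensor u (f.toLp 2 volume))) (tensor u (f.toLp 2 volume)),
        Lp.coeFn_smul (s : ℂ) (generatorVec u hu f), generatorVec_ae_eq u hu f,
        shear_tensor_ae_eq hq s u (f.toLp 2 volume), coeFn_tensor u (f.toLp 2 volume),
        ae_snd (μ := μ) (f.coeFn_toLp 2 volume),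
        (measurePreserving_shear hq s).quasiMeasurePreserving.ae
          (ae_snd (μ := μ) (f.coeFn_toLp 2 volume))] with z h1 h2 h3 h4 h5 h6 h7 h8
      rw [h1, Pi.sub_apply, h2, Pi.sub_apply, h3, Pi.smul_apply, h4, h5, h6, h7, h8]
      have e : ∑ j, ((s • q z.1) j : ℂ) * pderiv j f z.2 =
          (s : ℂ) * ∑ j, (q z.1 j : ℂ) * pderiv j f z.2 := by
        rw [Finset.mul_sum]
        refine Finset.sum_congr rfl fun j _ => ?_
        simp [mul_assoc]
      rw [e, smul_eq_mul]
      ring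
    filter_upwards [Measure.ae_ae_of_ae_prod h] with x hx
    filter_upwards [hx, translateRemainder_ae_eq f (s • q x)] with y h1 h2
    rw [h1, h2]
  -- The squared remainder, divided by `s ^ 2`, is dominated and tends to zero.
  let B : ℝ → X → ℝ≥0∞ := fun s x =>
    ‖u x‖ₑ ^ 2 * ENNReal.ofReal (C * min ‖q x‖ (|s| * ‖q x‖ ^ 2)) ^ 2
  have hle : ∀ s : ℝ, ‖shear μ hq s (tensor u (f.toLp 2 volume)) - tensor u (f.toLp 2 volume) -
      (s : ℂ) • generatorVec u hu f‖ₑ ^ 2 ≤ ENNReal.ofReal |s| ^ 2 * ∫⁻ x, B s x ∂μ := by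
    intro s
    rw [enorm_sq_eq_of_slice u _ _ (hslice s), ← lintegral_const_mul' _ _ (by finiteness)]
    refine lintegral_mono fun x => ?_
    rw [mul_left_comm]
    gcongr
    rw [← mul_pow, ← ENNReal.ofReal_mul (abs_nonneg s), ← ofReal_norm]
    gcongr
    refine (hC _).trans (le_of_eq ?_)
    rw [norm_smul, Real.norm_eq_abs, mul_left_comm, mul_min_of_nonneg _ _ (abs_nonneg s)]
    ring_nf
  have hum : Measurable (u : X → ℂ) := (Lp.stronglyMeasurable u).measurable
  have hB : Filter.Tendsto (fun s => ∫⁻ x, B s x ∂μ) (nhds 0) (nhds 0) := by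
    have h0 : ∫⁻ _, (0 : ℝ≥0∞) ∂μ = 0 := lintegral_zero
    rw [← h0]
    refine tendsto_lintegral_filter_of_dominated_convergence
      (fun x => ‖u x‖ₑ ^ 2 * ENNReal.ofReal (C * ‖q x‖) ^ 2)
      (Filter.Eventually.of_forall fun s => by fun_prop)
      (Filter.Eventually.of_forall fun s => Filter.Eventually.of_forall fun x => ?_)
      (lintegral_mul_norm_sq_ne_top hq u hu C) (Filter.Eventually.of_forall fun x => ?_)
    · simp only [B]
      gcongr
      exact min_le_left _ _
    · have h1 : Filter.Tendsto (fun s : ℝ => C * min ‖q x‖ (|s| * ‖q x‖ ^ 2)) (nhds 0)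
          (nhds 0) := by
        have : Continuous fun s : ℝ => C * min ‖q x‖ (|s| * ‖q x‖ ^ 2) := by fun_prop
        simpa using this.tendsto 0
      have h2 := (ENNReal.continuous_pow 2).tendsto _ |>.comp (ENNReal.tendsto_ofReal h1)
      have h3 := ENNReal.Tendsto.const_mul (a := ‖u x‖ₑ ^ 2) h2 (Or.inr (by finiteness))
      simpa using h3
  rw [hasDerivAt_iff_isLittleO, Asymptotics.isLittleO_iff]
  intro ε hε
  have hev := hB.eventually_lt_const (ENNReal.pow_pos (ENNReal.ofReal_pos.2 hε) 2)
  filter_upwards [hev] with s hs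
  have h2 := (hle s).trans (mul_le_mul_right hs.le _)
  rw [← mul_pow, ENNReal.pow_le_pow_left_iff two_ne_zero, ← ofReal_norm,
    ← ENNReal.ofReal_mul (abs_nonneg s), ENNReal.ofReal_le_ofReal_iff (by positivity)] at h2
  have e : s • generatorVec u hu f = (s : ℂ) • generatorVec u hu f := (Complex.coe_smul _ _).symm
  rw [sub_zero, shear_zero, Real.norm_eq_abs, mul_comm, e]
  exact h2

theorem smul_impulsive [SFinite μ] (q : X → Sp d) (γ σ : ℝ) {ħ : ℝ} (hħ : ħ ≠ 0) (u : Lp ℂ 2 μ)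
    (hu : ∀ j, u ∈ (multOp μ fun x => q x j).domain) (f : 𝓢(Sp d, ℂ)) :
    (σ * Complex.I / ħ : ℂ) • impulsive μ q γ ħ u hu f =
      ((σ * γ : ℝ) : ℂ) • generatorVec u hu f := by
  have e : ∀ j, tensor (multOp μ (fun x => q x j) ⟨u, hu j⟩) ((momentum ħ (dir j) f).toLp 2) =
      (-(Complex.I * ħ)) •
        tensor (multOp μ (fun x => q x j) ⟨u, hu j⟩) ((pderiv j f).toLp 2 volume) := by
    intro j
    rw [← tensor_smul_right]
    congr 1
  rw [impulsive, Finset.sum_congr rfl fun j _ => e j, ← Finset.smul_sum, smul_smul, smul_smul,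
    generatorVec]
  congr 1
  have : (ħ : ℂ) ≠ 0 := by exact_mod_cast hħ
  field_simp
  rw [Complex.I_sq]
  push_cast
  ring

theorem isGenerated_iff [SFinite μ] (q : X → Sp d) (γ σ : ℝ) {ħ : ℝ} (hħ : ħ ≠ 0)
    (G : UnitaryGroup (Joint d μ)) : IsGenerated μ q γ ħ σ G ↔
      ∀ (u : Lp ℂ 2 μ) (hu : ∀ j, u ∈ (multOp μ fun x => q x j).domain) (f : 𝓢(Sp d, ℂ)),
        HasDerivAt (fun t => G.U t (tensor u (f.toLp 2 volume)))
          (((σ * γ : ℝ) : ℂ) • generatorVec u hu f) 0 := by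
  simp only [IsGenerated, smul_impulsive q γ σ hħ]

/-- The shears are strongly continuous in `s`: they are differentiable at zero on the total set of
vectors `1_A ⊗ f`, they form a group, and they are isometries. -/
theorem continuous_shear [SigmaFinite μ] {q : X → Sp d} (hq : Measurable q) (Φ : Joint d μ) :
    Continuous fun s => shear μ hq s Φ := by
  let K : Submodule ℂ (Joint d μ) :=
    { carrier := {Φ | Continuous fun s => shear μ hq s Φ}
      add_mem' := fun h1 h2 => by
        simp only [Set.mem_ofPred_eq, map_add]
        exact Continuous.add h1 h2
      zero_mem' := by
        simp only [Set.mem_ofPred_eq, map_zero]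
        exact continuous_const
      smul_mem' := fun c Φ h => by
        simp only [Set.mem_ofPred_eq, map_smul]
        exact Continuous.const_smul h c }
  have hcl : IsClosed (K : Set (Joint d μ)) := by
    refine isClosed_of_closure_subset fun Φ hΦ => ?_
    obtain ⟨a, ha, hlim⟩ := mem_closure_iff_seq_limit.1 hΦ
    have hu : TendstoUniformly (fun n s => shear μ hq s (a n)) (fun s => shear μ hq s Φ)
        Filter.atTop := by
      rw [Metric.tendstoUniformly_iff]
      intro ε hε
      filter_upwards [(Metric.tendsto_nhds.1 hlim) ε hε] with n hn s
      rwa [(shear μ hq s).dist_map, dist_comm]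
    exact hu.continuous (Filter.Frequently.of_forall ha)
  have htop : K.topologicalClosure = ⊤ := by
    rw [Submodule.topologicalClosure_eq_top_iff, Submodule.eq_bot_iff]
    refine fun Φ hΦ => eq_zero_of_inner_tensor hq Φ fun A hA hμ n hn f => ?_
    refine (Submodule.mem_orthogonal K Φ).1 hΦ _ ?_
    have hc := (hasDerivAt_shear hq _ (indicator_mem_domain hq hA hμ hn) f).continuousAt
    refine continuous_iff_continuousAt.2 fun s => ?_
    have h2 : (fun r => shear μ hq r
          (tensor (indicatorConstLp 2 hA hμ (1 : ℂ)) (f.toLp 2 volume))) =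
        fun r => shear μ hq s (shear μ hq (r - s)
          (tensor (indicatorConstLp 2 hA hμ (1 : ℂ)) (f.toLp 2 volume))) := by
      ext1 r
      rw [← shear_add, add_sub_cancel]
    rw [h2]
    refine (shear μ hq s).continuous.continuousAt.comp ?_
    refine ContinuousAt.comp (g := fun r => shear μ hq r
      (tensor (indicatorConstLp 2 hA hμ (1 : ℂ)) (f.toLp 2 volume))) ?_ (by fun_prop)
    rw [sub_self]
    exact hc
  have : Φ ∈ K.topologicalClosure := by rw [htop]; trivial
  rwa [IsClosed.submodule_topologicalClosure_eq hcl] at this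

/-- The unitary group `(U(t) Φ)(x, y) = Φ(x, y + κ t q(x))`. -/
def shearGroup (μ : Measure X) [SigmaFinite μ] {q : X → Sp d} (hq : Measurable q) (κ : ℝ) :
    UnitaryGroup (Joint d μ) where
  U t := shear μ hq (κ * t)
  map_add s t Φ := by rw [mul_add, shear_add]
  continuous_apply Φ := (continuous_shear hq Φ).comp (by fun_prop)

theorem hasDerivAt_shear_mul [SFinite μ] {q : X → Sp d} (hq : Measurable q) (u : Lp ℂ 2 μ)
    (hu : ∀ j, u ∈ (multOp μ fun x => q x j).domain) (f : 𝓢(Sp d, ℂ)) (κ t : ℝ) :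
    HasDerivAt (fun t => shear μ hq (κ * t) (tensor u (f.toLp 2 volume)))
      ((κ : ℂ) • shear μ hq (κ * t) (generatorVec u hu f)) t := by
  have h1 : HasDerivAt (fun s : ℝ => κ * (s - t)) κ t := by
    simpa using ((hasDerivAt_id t).sub_const t).const_mul κ
  have h0 : HasDerivAt (fun s => shear μ hq s (tensor u (f.toLp 2 volume))) (generatorVec u hu f)
      (κ * (t - t)) := by
    rw [sub_self, mul_zero]
    exact hasDerivAt_shear hq u hu f
  have h2 := h0.scomp t h1
  have h3 := ((shear μ hq (κ * t)).toContinuousLinearEquiv.toContinuousLinearMap.restrictScalars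
    ℝ).hasFDerivAt.comp_hasDerivAt t h2
  have e : (fun t => shear μ hq (κ * t) (tensor u (f.toLp 2 volume))) = fun s =>
      shear μ hq (κ * t) (shear μ hq (κ * (s - t)) (tensor u (f.toLp 2 volume))) := by
    ext1 s
    rw [← shear_add]
    ring_nf
  rw [e]
  have h4 : (κ : ℂ) • shear μ hq (κ * t) (generatorVec u hu f) =
      shear μ hq (κ * t) (κ • generatorVec u hu f) := by
    rw [← map_smul]
    exact congrArg _ (Complex.coe_smul _ _)
  rw [h4]
  exact h3

theorem isGenerated_shearGroup [SigmaFinite μ] {q : X → Sp d} (hq : Measurable q) (γ σ : ℝ) {ħ : ℝ}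
    (hħ : ħ ≠ 0) : IsGenerated μ q γ ħ σ (shearGroup μ hq (σ * γ)) := by
  rw [isGenerated_iff q γ σ hħ]
  intro u hu f
  have h := hasDerivAt_shear_mul hq u hu f (σ * γ) 0
  rw [mul_zero, shear_zero] at h
  exact h

end Generator

/-! ### Uniqueness of the unitary group -/

section Uniqueness

variable {d : ℕ} {X : Type*} [MeasurableSpace X] {μ : Measure X}

theorem toLp_compSubConst (f : 𝓢(Sp d, ℂ)) (b : Sp d) :
    (f.compSubConstCLM ℂ (-b)).toLp 2 volume = translate b (f.toLp 2 volume) := by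
  apply Lp.ext
  filter_upwards [(f.compSubConstCLM ℂ (-b)).coeFn_toLp 2 volume, coeFn_translate_toLp f b]
    with y h1 h2
  rw [h1, h2, SchwartzMap.compSubConstCLM_apply, sub_neg_eq_add]

theorem pderiv_compSubConst (f : 𝓢(Sp d, ℂ)) (b : Sp d) (j : Fin d) :
    pderiv j (f.compSubConstCLM ℂ b) = (pderiv j f).compSubConstCLM ℂ b := by
  ext y
  rw [SchwartzMap.compSubConstCLM_apply, pderiv, pderiv, SchwartzMap.lineDerivOp_apply_eq_fderiv,
    SchwartzMap.lineDerivOp_apply_eq_fderiv]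
  have : (f.compSubConstCLM ℂ b : Sp d → ℂ) = fun y => f (y - b) := by
    ext1 y
    exact SchwartzMap.compSubConstCLM_apply _ _ _
  rw [this, fderiv_comp_sub]

/-- The decomposition of `1_A` along the fibers of a simple function. -/
theorem indicator_eq_sum_fibers (p : SimpleFunc X (Sp d)) {A : Set X} (hA : MeasurableSet A)
    (hμ : μ A ≠ ∞) (hm : ∀ c, MeasurableSet (A ∩ p ⁻¹' {c})) (hf : ∀ c, μ (A ∩ p ⁻¹' {c}) ≠ ∞) :
    indicatorConstLp 2 hA hμ (1 : ℂ) = ∑ c ∈ p.range, indicatorConstLp 2 (hm c) (hf c) (1 : ℂ) := by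
  apply Lp.ext
  have h : ∀ᵐ x ∂μ, ∀ c : p.range, indicatorConstLp 2 (hm c) (hf c) (1 : ℂ) x =
      (A ∩ p ⁻¹' {c.1}).indicator (fun _ => 1) x :=
    ae_all_iff.2 fun c => indicatorConstLp_coeFn
  filter_upwards [indicatorConstLp_coeFn (p := 2) (hs := hA) (hμs := hμ) (c := (1 : ℂ)),
    coeFn_finset_sum p.range fun c => indicatorConstLp 2 (hm c) (hf c) (1 : ℂ), h] with x h1 h2 h3
  have e : ∑ c ∈ p.range, indicatorConstLp 2 (hm c) (hf c) (1 : ℂ) x =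
      ∑ c ∈ p.range, (A ∩ p ⁻¹' {c}).indicator (fun _ => (1 : ℂ)) x :=
    Finset.sum_congr rfl fun c hc => h3 ⟨c, hc⟩
  rw [h1, h2, e]
  by_cases hx : x ∈ A
  · simp [Set.indicator, hx]
  · simp [Set.indicator, hx]

/-- The product rule for `G(-r) (W r)`. Only at the vector `W t` itself need the group be
differentiable. -/
theorem hasDerivAt_neg_apply (G : UnitaryGroup (Joint d μ)) {W : ℝ → Joint d μ} {t : ℝ}
    {w' l : Joint d μ} (hW : HasDerivAt W w' t) (hl : HasDerivAt (fun h => G.U h (W t)) l 0) :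
    HasDerivAt (fun r => G.U (-r) (W r)) (G.U (-t) (w' - l)) t := by
  have h1 : HasDerivAt (fun r => G.U (t - r) (W t)) (-l) t := by
    have h0 : HasDerivAt (fun r : ℝ => t - r) (-1) t := by simpa using (hasDerivAt_id t).const_sub t
    have hl' : HasDerivAt (fun h => G.U h (W t)) l (t - t) := by rwa [sub_self]
    have e : (-1 : ℝ) • l = -l := by rw [neg_smul, one_smul]
    rw [← e]
    exact hl'.scomp t h0
  -- `G(t - r) (W r - W t)` has derivative `w'` since `G` is isometric and strongly continuous.
  have h2 : HasDerivAt (fun r => G.U (t - r) (W r - W t)) w' t := by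
    rw [hasDerivAt_iff_isLittleO] at hW ⊢
    have e : ∀ r, G.U (t - r) (W r - W t) - G.U (t - t) (W t - W t) - (r - t) • w' =
        G.U (t - r) (W r - W t - (r - t) • w') + (r - t) • (G.U (t - r) w' - w') := fun r => by
      rw [sub_self (W t), map_zero, sub_zero, map_sub (G.U (t - r)) (W r - W t)]
      have : G.U (t - r) ((r - t) • w') = (r - t) • G.U (t - r) w' :=
        ((G.U (t - r)).toContinuousLinearEquiv.toContinuousLinearMap.restrictScalars ℝ).map_smul _ _
      rw [this, smul_sub]
      abel
    simp only [e]
    refine Asymptotics.IsLittleO.add ?_ ?_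
    · refine Asymptotics.IsLittleO.of_norm_left ?_
      simp only [LinearIsometryEquiv.norm_map]
      exact hW.norm_left
    · have h3 : (fun r => G.U (t - r) w' - w') =o[nhds t] fun _ => (1 : ℝ) := by
        rw [Asymptotics.isLittleO_one_iff]
        have hcont : Continuous fun r => G.U (t - r) w' - w' :=
          ((G.continuous_apply w').comp (by fun_prop : Continuous fun r : ℝ => t - r)).sub
            continuous_const
        have := hcont.tendsto t
        rwa [sub_self t, G.map_zero, sub_self] at this
      simpa using (Asymptotics.isBigO_refl (fun r : ℝ => r - t) (nhds t)).smul_isLittleO h3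
  have h3 := ((G.U (-t)).toContinuousLinearEquiv.toContinuousLinearMap.restrictScalars
    ℝ).hasFDerivAt.comp_hasDerivAt t (h2.add h1)
  have e1 : (fun r => G.U (-r) (W r)) = fun r =>
      G.U (-t) (G.U (t - r) (W r - W t) + G.U (t - r) (W t)) := by
    ext1 r
    rw [← map_add, sub_add_cancel, ← G.map_add]
    ring_nf
  rw [e1, sub_eq_add_neg]
  exact h3

variable [SFinite μ]

/-- Where `p` is constant, the shear by `p` is a translation, which commutes with the derivatives
in the generator of `q`. -/
theorem generatorVec_translate {q : X → Sp d} {p : X → Sp d} (hp : Measurable p) (s : ℝ)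
    (u : Lp ℂ 2 μ) (hu : ∀ j, u ∈ (multOp μ fun x => q x j).domain) {c : Sp d}
    (hc : ∀ᵐ x ∂μ, u x ≠ 0 → p x = c) (f : 𝓢(Sp d, ℂ)) :
    generatorVec u hu (f.compSubConstCLM ℂ (-(s • c))) = shear μ hp s (generatorVec u hu f) := by
  rw [generatorVec, generatorVec, map_sum]
  refine Finset.sum_congr rfl fun j _ => ?_
  rw [pderiv_compSubConst, toLp_compSubConst, shear_tensor_of_eq hp s (l := c)]
  filter_upwards [hc, multOp_ae_eq (⟨u, hu j⟩ : (multOp μ fun x => q x j).domain)] with x h1 h2 h3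
  refine h1 fun h0 => h3 ?_
  rw [h2, h0, mul_zero]

theorem generatorVec_sum {q : X → Sp d} {ι : Type*} (t : Finset ι) (w : ι → Lp ℂ 2 μ)
    (hw : ∀ i j, w i ∈ (multOp μ fun x => q x j).domain)
    (u : Lp ℂ 2 μ) (hu : ∀ j, u ∈ (multOp μ fun x => q x j).domain) (h : u = ∑ i ∈ t, w i)
    (f : 𝓢(Sp d, ℂ)) :
    generatorVec u hu f = ∑ i ∈ t, generatorVec (w i) (hw i) f := by
  simp only [generatorVec]
  rw [Finset.sum_comm]
  refine Finset.sum_congr rfl fun j _ => ?_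
  rw [← tensor_sum_left]
  congr 1
  have e : (⟨u, hu j⟩ : (multOp μ fun x => q x j).domain) = ∑ i ∈ t, ⟨w i, hw i j⟩ := by
    apply Subtype.ext
    exact h.trans (map_sum (Submodule.subtype _)
      (fun i => (⟨w i, hw i j⟩ : (multOp μ fun x => q x j).domain)) t).symm
  rw [e]
  exact map_sum (multOp μ fun x => q x j).toFun _ _

/-- The sheared vector `(1_A ⊗ f)(x, y + s p(x))` is a finite sum of vectors `1_B ⊗ g` if `p` takes
finitely many values. Hence a group with the generator of `q` is differentiable on it, and its
derivative commutes with the shear by `p`. -/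
theorem hasDerivAt_of_simpleFunc {q : X → Sp d} (hq : Measurable q) (κ : ℝ)
    (G : UnitaryGroup (Joint d μ))
    (hG : ∀ (u : Lp ℂ 2 μ) (hu : ∀ j, u ∈ (multOp μ fun x => q x j).domain) (f : 𝓢(Sp d, ℂ)),
      HasDerivAt (fun t => G.U t (tensor u (f.toLp 2 volume))) ((κ : ℂ) • generatorVec u hu f) 0)
    (p : SimpleFunc X (Sp d)) {A : Set X} (hA : MeasurableSet A) (hμ : μ A ≠ ∞) {n : ℝ}
    (hn : ∀ x ∈ A, ‖q x‖ ≤ n) (s : ℝ) (f : 𝓢(Sp d, ℂ)) :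
    HasDerivAt (fun t => G.U t (shear μ p.measurable s
        (tensor (indicatorConstLp 2 hA hμ (1 : ℂ)) (f.toLp 2 volume))))
      ((κ : ℂ) • shear μ p.measurable s
        (generatorVec _ (indicator_mem_domain hq hA hμ hn) f)) 0 := by
  have hm : ∀ c, MeasurableSet (A ∩ p ⁻¹' {c}) := fun c => hA.inter (p.measurableSet_preimage _)
  have hf : ∀ c, μ (A ∩ p ⁻¹' {c}) ≠ ∞ := fun c =>
    ne_top_of_le_ne_top hμ (measure_mono Set.inter_subset_left)
  have hd : ∀ c j, indicatorConstLp 2 (hm c) (hf c) (1 : ℂ) ∈ (multOp μ fun x => q x j).domain :=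
    fun c => indicator_mem_domain hq (hm c) (hf c) fun x hx => hn x hx.1
  have hc : ∀ c, ∀ᵐ x ∂μ, indicatorConstLp 2 (hm c) (hf c) (1 : ℂ) x ≠ 0 → p x = c := fun c => by
    filter_upwards [indicatorConstLp_coeFn (p := 2) (hs := hm c) (hμs := hf c) (c := (1 : ℂ))]
      with x hx h0
    rw [hx] at h0
    exact (Set.mem_of_indicator_ne_zero h0).2
  have hsum := indicator_eq_sum_fibers p hA hμ hm hf
  rw [generatorVec_sum p.range _ hd _ (indicator_mem_domain hq hA hμ hn) hsum, hsum,
    tensor_sum_left, map_sum, map_sum, Finset.smul_sum]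
  simp only [map_sum]
  refine HasDerivAt.fun_sum fun c _ => ?_
  rw [shear_tensor_of_eq _ s (hc c), ← toLp_compSubConst,
    ← generatorVec_translate p.measurable s _ (hd c) (hc c)]
  exact hG _ (hd c) _

/-- A measurable function which is bounded on `A` is there a uniform limit of simple functions. -/
theorem exists_simpleFunc_near {q : X → Sp d} (hq : Measurable q) {A : Set X} {n : ℝ}
    (hn : ∀ x ∈ A, ‖q x‖ ≤ n) {ε : ℝ} (hε : 0 < ε) :
    ∃ p : SimpleFunc X (Sp d), ∀ x ∈ A, ‖q x - p x‖ ≤ ε := by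
  let e := TopologicalSpace.denseSeq (Sp d)
  have hcov : Metric.closedBall (0 : Sp d) n ⊆ ⋃ k, Metric.ball (e k) ε := fun y _ => by
    obtain ⟨k, hk⟩ := (TopologicalSpace.denseRange_denseSeq (Sp d)).exists_dist_lt y hε
    exact Set.mem_iUnion.2 ⟨k, hk⟩
  obtain ⟨t, ht⟩ := (isCompact_closedBall (0 : Sp d) n).elim_finite_subcover _
    (fun k => Metric.isOpen_ball) hcov
  refine ⟨(SimpleFunc.nearestPt e (t.sup id)).comp q hq, fun x hx => ?_⟩
  obtain ⟨k, hk, hkx⟩ := Set.mem_iUnion₂.1 (ht (by simpa using hn x hx : q x ∈ _))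
  have h := SimpleFunc.edist_nearestPt_le e (q x) (Finset.le_sup (f := id) hk)
  rw [edist_dist, edist_dist, ENNReal.ofReal_le_ofReal_iff dist_nonneg, dist_comm, id,
    dist_comm (e k)] at h
  rw [SimpleFunc.coe_comp, Function.comp_apply, ← dist_eq_norm]
  exact h.trans (Metric.mem_ball.1 hkx).le

theorem norm_generatorVec_sub_le {q p : X → Sp d} (u : Lp ℂ 2 μ)
    (hu : ∀ j, u ∈ (multOp μ fun x => q x j).domain)
    (hu' : ∀ j, u ∈ (multOp μ fun x => p x j).domain) {ε : ℝ}
    (h : ∀ᵐ x ∂μ, u x ≠ 0 → ‖q x - p x‖ ≤ ε) (f : 𝓢(Sp d, ℂ)) :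
    ‖generatorVec u hu' f - generatorVec u hu f‖ ≤
      ∑ j, ε * ‖u‖ * ‖(pderiv j f).toLp 2 volume‖ := by
  rw [generatorVec, generatorVec, ← Finset.sum_sub_distrib]
  refine (norm_sum_le _ _).trans (Finset.sum_le_sum fun j _ => ?_)
  rw [← tensorLeft_apply, ← tensorLeft_apply, ← map_sub, tensorLeft_apply, norm_tensor]
  gcongr
  refine Lp.norm_le_mul_norm_of_ae_le_mul ?_
  filter_upwards [Lp.coeFn_sub (multOp μ (fun x => p x j) ⟨u, hu' j⟩)
      (multOp μ (fun x => q x j) ⟨u, hu j⟩),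
    multOp_ae_eq (⟨u, hu j⟩ : (multOp μ fun x => q x j).domain),
    multOp_ae_eq (⟨u, hu' j⟩ : (multOp μ fun x => p x j).domain), h] with x h1 h2 h3 h4
  rw [h1, Pi.sub_apply, h2, h3, ← sub_mul, norm_mul]
  by_cases h0 : u x = 0
  · simp [h0]
  · gcongr
    rw [← Complex.ofReal_sub, Complex.norm_real, norm_sub_rev]
    exact (PiLp.norm_apply_le (q x - p x) j).trans (h4 h0)

/-- A group with the generator of `q` is close to the shear by `p` on `1_A ⊗ f` if the simple
function `p` is uniformly close to `q` on `A`: the derivative of `G(-t) (shear by p)` is small. -/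
theorem norm_sub_shear_le {q : X → Sp d} (hq : Measurable q) (κ : ℝ)
    (G : UnitaryGroup (Joint d μ))
    (hG : ∀ (u : Lp ℂ 2 μ) (hu : ∀ j, u ∈ (multOp μ fun x => q x j).domain) (f : 𝓢(Sp d, ℂ)),
      HasDerivAt (fun t => G.U t (tensor u (f.toLp 2 volume))) ((κ : ℂ) • generatorVec u hu f) 0)
    (p : SimpleFunc X (Sp d)) {A : Set X} (hA : MeasurableSet A) (hμ : μ A ≠ ∞) {n ε : ℝ}
    (hn : ∀ x ∈ A, ‖q x‖ ≤ n) (hp : ∀ x ∈ A, ‖q x - p x‖ ≤ ε) (t : ℝ) (f : 𝓢(Sp d, ℂ)) :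
    ‖G.U t (tensor (indicatorConstLp 2 hA hμ (1 : ℂ)) (f.toLp 2 volume)) -
        shear μ p.measurable (κ * t)
          (tensor (indicatorConstLp 2 hA hμ (1 : ℂ)) (f.toLp 2 volume))‖ ≤
      |κ| * (∑ j, ε * ‖indicatorConstLp 2 hA hμ (1 : ℂ)‖ * ‖(pderiv j f).toLp 2 volume‖) * |t| := by
  set u := indicatorConstLp 2 hA hμ (1 : ℂ) with hu
  have hpn : ∀ x ∈ A, ‖p x‖ ≤ n + ε := fun x hx => by
    have := norm_sub_norm_le (p x) (q x)
    rw [norm_sub_rev] at this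
    linarith [hn x hx, hp x hx]
  have hdq := indicator_mem_domain hq hA hμ hn
  have hdp := indicator_mem_domain p.measurable hA hμ hpn
  have hder : ∀ r, HasDerivAt
      (fun r => G.U (-r) (shear μ p.measurable (κ * r) (tensor u (f.toLp 2 volume))))
      (G.U (-r) ((κ : ℂ) • shear μ p.measurable (κ * r) (generatorVec u hdp f) -
        (κ : ℂ) • shear μ p.measurable (κ * r) (generatorVec u hdq f))) r := fun r =>
    hasDerivAt_neg_apply G (hasDerivAt_shear_mul p.measurable u hdp f κ r)
      (hasDerivAt_of_simpleFunc hq κ G hG p hA hμ hn (κ * r) f)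
  have hb := convex_univ.norm_image_sub_le_of_norm_hasDerivWithin_le (𝕜 := ℝ) (x := 0) (y := t)
    (C := |κ| * ∑ j, ε * ‖u‖ * ‖(pderiv j f).toLp 2 volume‖)
    (fun r _ => (hder r).hasDerivWithinAt) (fun r _ => ?_) (Set.mem_univ _) (Set.mem_univ _)
  · rw [neg_zero, G.map_zero, mul_zero, shear_zero, sub_zero, ← (G.U t).norm_map, map_sub,
      G.map_map_neg, norm_sub_rev] at hb
    exact hb
  · rw [(G.U (-r)).norm_map, ← smul_sub, ← map_sub, norm_smul, (shear μ _ _).norm_map,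
      Complex.norm_real, Real.norm_eq_abs]
    gcongr
    refine norm_generatorVec_sub_le u hdq hdp ?_ f
    filter_upwards [indicatorConstLp_coeFn (p := 2) (hs := hA) (hμs := hμ) (c := (1 : ℂ))]
      with x hx h0
    rw [hx] at h0
    exact hp x (Set.mem_of_indicator_ne_zero h0)

end Uniqueness

/-- The group generated by the impulsive interaction is the shear group. -/
theorem IsGenerated.apply_eq {d : ℕ} {X : Type*} [MeasurableSpace X] {μ : Measure X}
    [SigmaFinite μ] {q : X → Sp d} (hq : Measurable q) {γ σ ħ : ℝ} (hħ : ħ ≠ 0)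
    {G : UnitaryGroup (Joint d μ)} (hG : IsGenerated μ q γ ħ σ G) (t : ℝ) (Φ : Joint d μ) :
    G.U t Φ = shear μ hq (σ * γ * t) Φ := by
  have h0 := isGenerated_shearGroup (μ := μ) hq γ σ hħ
  rw [isGenerated_iff q γ σ hħ] at hG h0
  have key := eq_of_eq_tensor hq ((G.U t).toContinuousLinearEquiv : Joint d μ →L[ℂ] Joint d μ)
    ((shear μ hq (σ * γ * t)).toContinuousLinearEquiv : Joint d μ →L[ℂ] Joint d μ) ?_
  · exact congrArg (fun V : Joint d μ →L[ℂ] Joint d μ => V Φ) key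
  · intro A hA hμ n hn f
    change G.U t _ = (shearGroup μ hq (σ * γ)).U t _
    set u := indicatorConstLp 2 hA hμ (1 : ℂ)
    let C := |σ * γ| * (∑ j, ‖u‖ * ‖(pderiv j f).toLp 2 volume‖) * |t|
    have hC : ∀ ε, |σ * γ| * (∑ j, ε * ‖u‖ * ‖(pderiv j f).toLp 2 volume‖) * |t| = ε * C :=
      fun ε => by
        simp only [C, mul_assoc ε, ← Finset.mul_sum]
        ring
    rw [← sub_eq_zero, ← norm_le_zero_iff]
    -- Both groups are close to the shear by a simple function near `q`.
    have hle : ∀ ε > 0, ‖G.U t (tensor u (f.toLp 2 volume)) -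
        (shearGroup μ hq (σ * γ)).U t (tensor u (f.toLp 2 volume))‖ ≤ ε * (2 * C) := fun ε hε => by
      obtain ⟨p, hp⟩ := exists_simpleFunc_near hq hn hε
      have h1 := norm_sub_shear_le hq (σ * γ) G hG p hA hμ hn hp t f
      have h2 := norm_sub_shear_le hq (σ * γ) (shearGroup μ hq (σ * γ)) h0 p hA hμ hn hp t f
      rw [hC] at h1 h2
      rw [norm_sub_rev] at h2
      exact (norm_sub_le_norm_sub_add_norm_sub _ _ _).trans
        ((add_le_add h1 h2).trans_eq (by ring))
    have hlim : Filter.Tendsto (fun ε : ℝ => ε * (2 * C)) (nhdsWithin 0 (Set.Ioi 0)) (nhds 0) := by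
      have : Continuous fun ε : ℝ => ε * (2 * C) := by fun_prop
      have h := (this.tendsto 0).mono_left (nhdsWithin_le_nhds (s := Set.Ioi 0))
      rwa [zero_mul] at h
    exact ge_of_tendsto hlim (Filter.eventually_of_mem self_mem_nhdsWithin hle)

theorem existsUnique_isGenerated {d : ℕ} {X : Type*} [MeasurableSpace X] {μ : Measure X}
    [SigmaFinite μ] {q : X → Sp d} (hq : Measurable q) (γ σ : ℝ) {ħ : ℝ} (hħ : ħ ≠ 0) :
    ∃! G : UnitaryGroup (Joint d μ), IsGenerated μ q γ ħ σ G := by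
  refine ⟨shearGroup μ hq (σ * γ), isGenerated_shearGroup hq γ σ hħ, fun G hG => ?_⟩
  have h : G.U = (shearGroup μ hq (σ * γ)).U := by
    ext1 t
    ext1 Φ
    exact hG.apply_eq hq hħ t Φ
  cases G
  subst h
  rfl

/-! ### Measurements of eigenvectors and approximate eigenvectors -/

section Measurement

variable {d : ℕ} {X : Type*} [MeasurableSpace X] {μ : Measure X}

theorem IsEigen.ae_eq {q : X → Sp d} {l : Sp d} {ψ : Lp ℂ 2 μ} (h : IsEigen q l ψ) :
    ∀ᵐ x ∂μ, ψ x ≠ 0 → q x = l := by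
  have hj : ∀ᵐ x ∂μ, ∀ j, (q x j : ℂ) * ψ x = (l j : ℂ) * ψ x := ae_all_iff.2 fun j => by
    obtain ⟨hd, he⟩ := h j
    filter_upwards [multOp_ae_eq (⟨ψ, hd⟩ : (multOp μ fun x => q x j).domain),
      Lp.coeFn_smul (l j : ℂ) ψ] with x h1 h2
    rw [← h1, he, h2, Pi.smul_apply, smul_eq_mul]
  filter_upwards [hj] with x hx h0
  ext j
  exact_mod_cast mul_right_cancel₀ h0 (hx j)

theorem IsMeasurand.ae_eq {q : X → Sp d} {j : Fin d} {𝒜 : OStarAlgebra (Joint d μ)}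
    {Q : Module.End ℂ 𝒜.domain} (hQ : IsMeasurand q j 𝒜 Q) (Φ : 𝒜.domain) :
    ∀ᵐ z ∂(μ.prod volume), (Q Φ : Joint d μ) z = (q z.1 j : ℂ) * (Φ : Joint d μ) z := by
  obtain ⟨hd, he⟩ := hQ Φ
  have h := multOp_ae_eq (ν := μ.prod (volume : Measure (Sp d))) (g := fun z => q z.1 j) ⟨Φ, hd⟩
  filter_upwards [h] with z hz
  rw [he, hz]

/-- The measurand commutes with the evolution. -/
theorem IsMeasurand.commute [SFinite μ] {q : X → Sp d} (hq : Measurable q) {j : Fin d}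
    {𝒜 : OStarAlgebra (Joint d μ)} {Q : Module.End ℂ 𝒜.domain} (hQ : IsMeasurand q j 𝒜 Q) (s : ℝ)
    (Φ Φ' : 𝒜.domain) (h : (Φ' : Joint d μ) = shear μ hq s Φ) :
    (Q Φ' : Joint d μ) = shear μ hq s (Q Φ) := by
  apply Lp.ext
  filter_upwards [hQ.ae_eq Φ', shear_ae_eq hq s (Φ : Joint d μ),
    shear_ae_eq hq s (Q Φ : Joint d μ),
    (measurePreserving_shear hq s).quasiMeasurePreserving.ae (hQ.ae_eq Φ)] with z h1 h2 h3 h4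
  rw [h1, h3, h4, h, h2]

/-- The pointer wave function is a partial inner product of the evolved wave function. -/
theorem isPointer_contract [SigmaFinite μ] {q : X → Sp d} (hq : Measurable q) (s : ℝ)
    (ψ : Lp ℂ 2 μ) (φ : Lp ℂ 2 (volume : Measure (Sp d))) :
    IsPointer q s ψ φ (contract d ψ (shear μ hq s (tensor ψ φ))) := by
  have h := Measure.ae_ae_of_ae_prod ((Measure.measurePreserving_swap (μ := volume)
    (ν := μ)).quasiMeasurePreserving.ae (shear_tensor_ae_eq hq s ψ φ))
  filter_upwards [contract_ae_eq ψ (shear μ hq s (tensor ψ φ)), h] with y h1 h2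
  rw [h1]
  refine integral_congr_ae ?_
  filter_upwards [h2] with x hx
  rw [Prod.swap_prod_mk] at hx
  rw [hx, ← mul_assoc, ← Complex.normSq_eq_conj_mul_self, Complex.normSq_eq_norm_sq]

theorem translate_add (a b : Sp d) (φ : Lp ℂ 2 (volume : Measure (Sp d))) :
    translate (a + b) φ = translate a (translate b φ) := by
  apply Lp.ext
  filter_upwards [translate_ae_eq (a + b) φ, translate_ae_eq a (translate b φ),
    (measurePreserving_add_right volume a).quasiMeasurePreserving.ae (translate_ae_eq b φ)]
    with y h1 h2 h3
  rw [h1, h2, h3, add_assoc]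

/-- A square integrable function whose modulus is periodic vanishes: by Poincaré recurrence for the
finite measure with density `|φ|²`, the translation cannot move almost all points of a ball away
from it. -/
theorem eq_zero_of_norm_periodic (φ : Lp ℂ 2 (volume : Measure (Sp d))) {p : Sp d} (hp : p ≠ 0)
    (h : ∀ᵐ y, ‖φ (y + p)‖ = ‖φ y‖) : φ = 0 := by
  have hm : Measurable fun y => ‖φ y‖ₑ ^ 2 := (Lp.stronglyMeasurable φ).measurable.enorm.pow_const 2
  let ν : Measure (Sp d) := volume.withDensity fun y => ‖φ y‖ₑ ^ 2
  have hν : ν Set.univ = ‖φ‖ₑ ^ 2 := by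
    rw [withDensity_apply _ MeasurableSet.univ, Measure.restrict_univ, enorm_sq_eq_lintegral]
  have hfin : IsFiniteMeasure ν := ⟨by rw [hν]; finiteness⟩
  have hT := measurePreserving_add_right (volume : Measure (Sp d)) p
  have hpres : MeasurePreserving (fun y => y + p) ν ν := by
    refine ⟨hT.measurable, Measure.ext fun s hs => ?_⟩
    rw [Measure.map_apply hT.measurable hs, withDensity_apply _ hs,
      withDensity_apply _ (hT.measurable hs), ← hT.setLIntegral_comp_preimage hs hm]
    refine lintegral_congr_ae (ae_restrict_of_ae ?_)
    filter_upwards [h] with y hy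
    rw [← ofReal_norm, ← ofReal_norm, hy]
  have hball : ∀ R : ℝ, ν (Metric.ball 0 R) = 0 := fun R => by
    have hrec := hpres.conservative.ae_mem_imp_frequently_image_mem
      (s := Metric.ball 0 R) measurableSet_ball.nullMeasurableSet
    rw [measure_eq_zero_iff_ae_notMem]
    filter_upwards [hrec] with y hy hyR
    obtain ⟨N, hN⟩ := exists_nat_ge (2 * R / ‖p‖)
    obtain ⟨n, hn, hnR⟩ := Filter.frequently_atTop.1 (hy hyR) N
    have hit : (fun y => y + p)^[n] y = y + n • p := by
      rw [add_right_iterate]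
    rw [hit, mem_ball_zero_iff] at hnR
    have hp0 : 0 < ‖p‖ := norm_pos_iff.2 hp
    have h1 : 2 * R ≤ n * ‖p‖ := by
      rw [div_le_iff₀ hp0] at hN
      exact hN.trans (by gcongr)
    have h2 : ‖n • p‖ = n * ‖p‖ := by rw [← Nat.cast_smul_eq_nsmul ℝ, norm_smul]; simp
    have h3 := norm_le_add_norm_add (n • p) y
    rw [add_comm (n • p)] at h3
    linarith [mem_ball_zero_iff.1 hyR]
  have h0 : ν Set.univ = 0 := by
    have hU : (Set.univ : Set (Sp d)) = ⋃ n : ℕ, Metric.ball 0 (n : ℝ) :=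
      (Metric.iUnion_ball_nat 0).symm
    rw [hU]
    exact measure_iUnion_null fun n => hball n
  rw [hν] at h0
  simpa using h0

/-- Different translates of a nonzero wave function are linearly independent. -/
theorem translate_ne_smul_translate {φ : Lp ℂ 2 (volume : Measure (Sp d))} (hφ : φ ≠ 0)
    {a b : Sp d} (hab : a ≠ b) (c : ℂ) : translate a φ ≠ c • translate b φ := by
  intro h
  have hφ' : ‖φ‖ ≠ 0 := norm_ne_zero_iff.2 hφ
  have hc : ‖c‖ = 1 := by
    have := congrArg norm h
    rw [norm_smul, (translate a).norm_map, (translate b).norm_map] at this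
    exact mul_right_cancel₀ hφ' (by rw [← this, one_mul])
  refine hφ (eq_zero_of_norm_periodic φ (sub_ne_zero.2 hab) ?_)
  have h2 : translate (a - b) φ = c • φ := by
    refine (translate b).injective ?_
    rw [← translate_add, add_sub_cancel, h, map_smul]
  filter_upwards [translate_ae_eq (a - b) φ, Lp.coeFn_smul c φ] with y h3 h4
  rw [← h3, h2, h4, Pi.smul_apply, norm_smul, hc, one_mul]

/-- If the vector were `u ⊗ v`, its partial inner products with `ψp` and `ψm` would be multiples of
`v`, hence the two translates of `φ` multiples of each other. -/
theorem isEntangled_of_ne [SFinite μ] {ψp ψm : Lp ℂ 2 μ} (hp : ‖ψp‖ = 1)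
    (hm : ‖ψm‖ = 1) (hpm : ⟪ψp, ψm⟫_ℂ = 0) {φ : Lp ℂ 2 (volume : Measure (Sp d))} (hφ : φ ≠ 0)
    {a b : Sp d} (hab : a ≠ b) {α β : ℂ} (hα : α ≠ 0) (hβ : β ≠ 0) :
    IsEntangled μ (α • tensor ψp (translate a φ) + β • tensor ψm (translate b φ)) := by
  rintro ⟨u, v, h⟩
  have hmp : ⟪ψm, ψp⟫_ℂ = 0 := inner_eq_zero_symm.1 hpm
  have hpp : ⟪ψp, ψp⟫_ℂ = 1 := by rw [inner_self_eq_norm_sq_to_K, hp]; simp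
  have hmm : ⟪ψm, ψm⟫_ℂ = 1 := by rw [inner_self_eq_norm_sq_to_K, hm]; simp
  have e1 := congrArg (contract d ψp) h
  have e2 := congrArg (contract d ψm) h
  simp only [map_add, map_smul, contract_tensor, hpp, hmm, hpm, hmp, zero_smul, one_smul, smul_zero,
    add_zero, zero_add] at e1 e2
  have hb : translate b φ ≠ 0 := fun h0 => hφ ((translate b).injective (by rw [h0, map_zero]))
  have hc : ⟪ψm, u⟫_ℂ ≠ 0 := fun h0 => by
    rw [h0, zero_smul] at e2
    exact (smul_ne_zero hβ hb) e2
  refine translate_ne_smul_translate hφ hab (α⁻¹ * ⟪ψp, u⟫_ℂ * ((⟪ψm, u⟫_ℂ)⁻¹ * β)) ?_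
  rw [mul_smul, mul_smul (⟪ψm, u⟫_ℂ)⁻¹, e2, inv_smul_smul₀ hc, mul_smul, ← e1, inv_smul_smul₀ hα]

theorem norm_superposition {ψp ψm : Lp ℂ 2 μ} (hp : ‖ψp‖ = 1) (hm : ‖ψm‖ = 1)
    (hpm : ⟪ψp, ψm⟫_ℂ = 0) {α β : ℂ} (h : ‖α‖ ^ 2 + ‖β‖ ^ 2 = 1) : ‖α • ψp + β • ψm‖ = 1 := by
  have h1 := norm_add_sq (𝕜 := ℂ) (α • ψp) (β • ψm)
  rw [inner_smul_left, inner_smul_right, hpm, mul_zero, mul_zero, norm_smul, norm_smul, hp, hm,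
    mul_one, mul_one, map_zero, mul_zero, add_zero, h] at h1
  exact (sq_eq_sq₀ (norm_nonneg _) zero_le_one).1 (by rw [h1, one_pow])

/-- If `q` differs little from `l` wherever `ψ ≠ 0`, the evolution of `ψ ⊗ φ` nearly is a
translation. -/
theorem norm_shear_sub_tensor_le [SFinite μ] {q : X → Sp d} (hq : Measurable q) (s : ℝ)
    {ψ : Lp ℂ 2 μ} (hψ : ‖ψ‖ = 1) {l : Sp d} {φ : Lp ℂ 2 (volume : Measure (Sp d))} {r ε : ℝ}
    (hε : 0 ≤ ε) (hr : ∀ b : Sp d, ‖b‖ ≤ |s| * r → ‖translate b φ - φ‖ ≤ ε)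
    (h : ∀ᵐ x ∂μ, ψ x ≠ 0 → ‖q x - l‖ ≤ r) :
    ‖shear μ hq s (tensor ψ φ) - tensor ψ (translate (s • l) φ)‖ ≤ ε := by
  have key := norm_le_of_slice (c := ε) ψ
    (shear μ hq s (tensor ψ φ) - tensor ψ (translate (s • l) φ))
    (fun x => translate (s • q x) φ - translate (s • l) φ) ?_ hε ?_
  · rwa [hψ, mul_one] at key
  · have h1 : ∀ᵐ z ∂(μ.prod (volume : Measure (Sp d))),
        (shear μ hq s (tensor ψ φ) - tensor ψ (translate (s • l) φ) : Joint d μ) z =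
          ψ z.1 * (φ (z.2 + s • q z.1) - φ (z.2 + s • l)) := by
      filter_upwards [Lp.coeFn_sub (shear μ hq s (tensor ψ φ)) (tensor ψ (translate (s • l) φ)),
        shear_tensor_ae_eq hq s ψ φ, coeFn_tensor ψ (translate (s • l) φ),
        ae_snd (μ := μ) (translate_ae_eq (s • l) φ)] with z h1 h2 h3 h4
      rw [h1, Pi.sub_apply, h2, h3, h4, mul_sub]
    filter_upwards [Measure.ae_ae_of_ae_prod h1] with x hx
    filter_upwards [hx, Lp.coeFn_sub (translate (s • q x) φ) (translate (s • l) φ),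
      translate_ae_eq (s • q x) φ, translate_ae_eq (s • l) φ] with y h2 h3 h4 h5
    rw [h2, h3, Pi.sub_apply, h4, h5]
  · filter_upwards [h] with x hx h0
    have e : translate (s • q x) φ = translate (s • l) (translate (s • (q x - l)) φ) := by
      rw [← translate_add, smul_sub, add_sub_cancel]
    rw [e, ← map_sub, (translate (s • l)).norm_map]
    refine hr _ ?_
    rw [norm_smul, Real.norm_eq_abs]
    gcongr
    exact hx h0

/-- The pointer wave function and the translate of `φ` differ by a partial inner product of an
error of norm at most `ε`, so that replacing the one by the other costs another `ε`. -/
theorem norm_shear_sub_pointer_le [SFinite μ] {q : X → Sp d} (hq : Measurable q) (s : ℝ)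
    {ψ : Lp ℂ 2 μ} (hψ : ‖ψ‖ = 1) {l : Sp d} {φ : Lp ℂ 2 (volume : Measure (Sp d))} {r ε : ℝ}
    (hε : 0 ≤ ε) (hr : ∀ b : Sp d, ‖b‖ ≤ |s| * r → ‖translate b φ - φ‖ ≤ ε)
    (h : ∀ᵐ x ∂μ, ψ x ≠ 0 → ‖q x - l‖ ≤ r) :
    ‖shear μ hq s (tensor ψ φ) - tensor ψ (contract d ψ (shear μ hq s (tensor ψ φ)))‖ ≤ 2 * ε := by
  have h1 := norm_shear_sub_tensor_le hq s hψ hε hr h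
  have hψψ : ⟪ψ, ψ⟫_ℂ = 1 := by rw [inner_self_eq_norm_sq_to_K, hψ]; simp
  have h2 : ‖contract d ψ (shear μ hq s (tensor ψ φ)) - translate (s • l) φ‖ ≤ ε := by
    have e : contract d ψ (shear μ hq s (tensor ψ φ)) - translate (s • l) φ =
        contract d ψ (shear μ hq s (tensor ψ φ) - tensor ψ (translate (s • l) φ)) := by
      rw [map_sub, contract_tensor, hψψ, one_smul]
    rw [e]
    refine (norm_contract_le _ _).trans ?_
    rwa [hψ, one_mul]
  have h3 : ‖tensor ψ (translate (s • l) φ) -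
      tensor ψ (contract d ψ (shear μ hq s (tensor ψ φ)))‖ ≤ ε := by
    rw [← tensorRight_apply, ← tensorRight_apply, ← map_sub, tensorRight_apply, norm_tensor, hψ,
      one_mul, norm_sub_rev]
    exact h2
  linarith [norm_sub_le_norm_sub_add_norm_sub (shear μ hq s (tensor ψ φ))
    (tensor ψ (translate (s • l) φ)) (tensor ψ (contract d ψ (shear μ hq s (tensor ψ φ))))]

theorem exists_translate_near (φ : Lp ℂ 2 (volume : Measure (Sp d))) (s : ℝ) {ε : ℝ} (hε : 0 < ε) :
    ∃ r : ℝ, 0 < r ∧ ∀ b : Sp d, ‖b‖ ≤ |s| * r → ‖translate b φ - φ‖ ≤ ε := by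
  obtain ⟨ρ, hρ, h⟩ := Metric.continuous_iff.1 (continuous_translate φ) 0 ε hε
  have hs : 0 < |s| + 1 := by positivity
  refine ⟨ρ / (|s| + 1), by positivity, fun b hb => ?_⟩
  have h1 : |s| * (ρ / (|s| + 1)) < ρ := by
    rw [mul_div_assoc', div_lt_iff₀ hs]
    nlinarith
  have h2 := h b (by rw [dist_zero_right]; exact hb.trans_lt h1)
  rw [translate_zero, dist_eq_norm] at h2
  exact h2.le

theorem isPointer_translate [SigmaFinite μ] {q : X → Sp d} (hq : Measurable q) (s : ℝ)
    {ψ : Lp ℂ 2 μ} {l : Sp d} (hl : IsEigen q l ψ) (hψ : ‖ψ‖ = 1)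
    (φ : Lp ℂ 2 (volume : Measure (Sp d))) : IsPointer q s ψ φ (translate (s • l) φ) := by
  have h := isPointer_contract hq s ψ φ
  rwa [shear_tensor_of_eq hq s hl.ae_eq, contract_tensor, inner_self_eq_norm_sq_to_K, hψ,
    RCLike.ofReal_one, one_pow, one_smul] at h

theorem shear_superposition [SFinite μ] {q : X → Sp d} (hq : Measurable q) (s : ℝ)
    (ψp ψm : Lp ℂ 2 μ) (φ : Lp ℂ 2 (volume : Measure (Sp d))) (α β : ℂ) :
    shear μ hq s (tensor (α • ψp + β • ψm) φ) =
      α • shear μ hq s (tensor ψp φ) + β • shear μ hq s (tensor ψm φ) := by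
  rw [tensor_add_left, tensor_smul_left, tensor_smul_left, map_add, map_smul, map_smul]

theorem norm_shear_superposition_sub_le [SFinite μ] {q : X → Sp d} (hq : Measurable q) (s : ℝ)
    {ψp ψm : Lp ℂ 2 μ} {φ φp φm : Lp ℂ 2 (volume : Measure (Sp d))} {α β : ℂ} {ε : ℝ}
    (hαβ : ‖α‖ ^ 2 + ‖β‖ ^ 2 = 1)
    (hp : ‖shear μ hq s (tensor ψp φ) - tensor ψp φp‖ ≤ ε)
    (hm : ‖shear μ hq s (tensor ψm φ) - tensor ψm φm‖ ≤ ε) :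
    ‖shear μ hq s (tensor (α • ψp + β • ψm) φ) - (α • tensor ψp φp + β • tensor ψm φm)‖ ≤
      2 * ε := by
  have hα : ‖α‖ ≤ 1 := by nlinarith [norm_nonneg α, sq_nonneg ‖β‖]
  have hβ : ‖β‖ ≤ 1 := by nlinarith [norm_nonneg β, sq_nonneg ‖α‖]
  rw [shear_superposition, add_sub_add_comm, ← smul_sub, ← smul_sub]
  refine (norm_add_le _ _).trans ?_
  rw [norm_smul, norm_smul]
  have h3 := mul_le_mul hα hp (norm_nonneg _) zero_le_one
  have h4 := mul_le_mul hβ hm (norm_nonneg _) zero_le_one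
  linarith

theorem exists_pointer_near [SigmaFinite μ] {q : X → Sp d} (hq : Measurable q) (s : ℝ)
    (φ : Lp ℂ 2 (volume : Measure (Sp d))) {η : ℝ} (hη : 0 < η) :
    ∃ r : ℝ, 0 < r ∧ ∀ (ψp ψm : Lp ℂ 2 μ) (lp lm : Sp d) (α β : ℂ),
      (∀ᵐ x ∂μ, ψp x ≠ 0 → ‖q x - lp‖ ≤ r) → (∀ᵐ x ∂μ, ψm x ≠ 0 → ‖q x - lm‖ ≤ r) →
      ‖ψp‖ = 1 → ‖ψm‖ = 1 → ‖α‖ ^ 2 + ‖β‖ ^ 2 = 1 →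
      ∃ φp φm : Lp ℂ 2 (volume : Measure (Sp d)), IsPointer q s ψp φ φp ∧ IsPointer q s ψm φ φm ∧
        ‖shear μ hq s (tensor (α • ψp + β • ψm) φ) -
          (α • tensor ψp φp + β • tensor ψm φm)‖ ≤ η := by
  -- Each of the two components contributes an error of at most `2 * (η / 4)`.
  obtain ⟨r, hr, hnear⟩ := exists_translate_near φ s (ε := η / 4) (by positivity)
  refine ⟨r, hr, fun ψp ψm lp lm α β hqp hqm hp hm hαβ => ?_⟩
  refine ⟨_, _, isPointer_contract hq s ψp φ, isPointer_contract hq s ψm φ, ?_⟩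
  have hη4 : 0 ≤ η / 4 := by positivity
  exact (norm_shear_superposition_sub_le hq s hαβ
    (norm_shear_sub_pointer_le hq s hp hη4 hnear hqp)
    (norm_shear_sub_pointer_le hq s hm hη4 hnear hqm)).trans_eq (by ring)

theorem evolvesTo_of_shear [SFinite μ] {q : X → Sp d} (hq : Measurable q)
    {G : UnitaryGroup (Joint d μ)} {𝒜 : OStarAlgebra (Joint d μ)} (hA : ActsOnStates G 𝒜)
    {t₁ t₂ s : ℝ} (hs : ∀ Φ, G.U (t₂ - t₁) Φ = shear μ hq s Φ) (δ : ℝ) {Ψ₁ Ψ₂ : Joint d μ}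
    (hΨ : Ψ₁ ∈ 𝒜.domain) (hn : ‖Ψ₁‖ = 1) (h2 : G.U (t₂ - t₁) Ψ₁ = Ψ₂) :
    EvolvesTo G t₁ t₂ (nu 𝒜 (proj Ψ₁) δ) (nu 𝒜 (proj Ψ₂) δ) ∧
      ∀ j, ∀ Q ∈ 𝒜.alg, IsMeasurand q j 𝒜 Q →
        EvolvesTo G t₁ t₂ (subNu 𝒜 (proj Ψ₁) Q δ) (subNu 𝒜 (proj Ψ₂) Q δ) := by
  subst h2
  refine ⟨evolvesTo_nu G 𝒜 hA t₁ t₂ δ Ψ₁, fun j Q hQ hm =>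
    evolvesTo_subNu G 𝒜 hA t₁ t₂ δ hΨ hn hQ fun x y h => ?_⟩
  rw [hs] at h ⊢
  exact hm.commute hq s x y h

end Measurement

/-! ### The action on the smooth states of two particles -/

section Weyl

/-- A unitary operator acts on the smooth states if it preserves the common domain and conjugation
by its inverse maps the algebra into itself. -/
theorem OStarAlgebra.IsState.conj_of_conj_mem {H : Type*} [NormedAddCommGroup H]
    [InnerProductSpace ℂ H] [CompleteSpace H] {𝒜 : OStarAlgebra H} {V : H ≃ₗᵢ[ℂ] H}
    (hV : ∀ x ∈ 𝒜.domain, V x ∈ 𝒜.domain)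
    (hA : ∀ A ∈ 𝒜.alg, ∃ B ∈ 𝒜.alg, ∀ x y : 𝒜.domain, (y : H) = V x → (A y : H) = V (B x))
    {ρ : H →L[ℂ] H} (hρ : 𝒜.IsState ρ) : 𝒜.IsState (conj V ρ) where
  pos := isPositive_conj V hρ.pos
  traceClass := by
    rw [IsTraceClass, traceNorm_conj]
    exact hρ.traceClass
  trace_eq_one := by rw [trace_conj V hρ.traceClass, hρ.trace_eq_one]
  mem_domain x := hV _ (hρ.mem_domain _)
  traceClass_mul A h := by
    obtain ⟨B, hB, e⟩ := hA A h
    obtain ⟨T, hT, hTt⟩ := hρ.traceClass_mul B hB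
    refine ⟨conj V T, fun x => ?_, by rw [IsTraceClass, traceNorm_conj]; exact hTt⟩
    rw [conj_apply, hT]
    exact (e ⟨ρ (V.symm x), hρ.mem_domain _⟩ _ rfl).symm

variable {d : ℕ}

/-- The linear shear `(x, y) ↦ (x, y + s x)`. -/
def shearMap (d : ℕ) (s : ℝ) : (Sp d × Sp d) →L[ℝ] Sp d × Sp d :=
  (ContinuousLinearMap.fst ℝ _ _).prod
    (ContinuousLinearMap.snd ℝ _ _ + s • ContinuousLinearMap.fst ℝ _ _)

theorem shearMap_apply (s : ℝ) (z : Sp d × Sp d) : shearMap d s z = (z.1, z.2 + s • z.1) := rfl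

/-- The linear shear as an equivalence. -/
def shearEquiv (d : ℕ) (s : ℝ) : (Sp d × Sp d) ≃L[ℝ] Sp d × Sp d :=
  ContinuousLinearEquiv.equivOfInverse (shearMap d s) (shearMap d (-s))
    (fun z => by simp [shearMap_apply]) (fun z => by simp [shearMap_apply])

theorem shearEquiv_apply (s : ℝ) (z : Sp d × Sp d) : shearEquiv d s z = (z.1, z.2 + s • z.1) := rfl

theorem shearEquiv_symm_apply (s : ℝ) (z : Sp d × Sp d) :
    (shearEquiv d s).symm z = (z.1, z.2 + (-s) • z.1) := rfl

/-- Composition of Schwartz functions with the shear. -/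
def schwartzShear (d : ℕ) (s : ℝ) : 𝓢(Sp d × Sp d, ℂ) ≃ₗ[ℂ] 𝓢(Sp d × Sp d, ℂ) :=
  LinearEquiv.ofLinearMap
    (SchwartzMap.compCLMOfContinuousLinearEquiv ℂ (shearEquiv d s)).toLinearMap
    (SchwartzMap.compCLMOfContinuousLinearEquiv ℂ (shearEquiv d s).symm).toLinearMap
    (by ext f z; simp) (by ext f z; simp)

theorem schwartzShear_apply (s : ℝ) (f : 𝓢(Sp d × Sp d, ℂ)) (z : Sp d × Sp d) :
    schwartzShear d s f z = f (shearEquiv d s z) := rfl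

theorem schwartzIncl_ae_eq (f : 𝓢(Sp d × Sp d, ℂ)) :
    ∀ᵐ z ∂((volume : Measure (Sp d)).prod (volume : Measure (Sp d))), schwartzIncl d f z = f z :=
  f.coeFn_toLp 2 _

theorem schwartzIncl_schwartzShear (s : ℝ) (f : 𝓢(Sp d × Sp d, ℂ)) :
    schwartzIncl d (schwartzShear d s f) = shear volume measurable_id' s (schwartzIncl d f) := by
  apply Lp.ext
  filter_upwards [schwartzIncl_ae_eq (schwartzShear d s f),
    shear_ae_eq measurable_id' s (schwartzIncl d f),
    (measurePreserving_shear (μ := (volume : Measure (Sp d)))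
      measurable_id' s).quasiMeasurePreserving.ae (schwartzIncl_ae_eq f)] with z h1 h2 h3
  rw [h1, h2, h3, schwartzShear_apply, shearEquiv_apply]

theorem position_apply (L : Sp d × Sp d →L[ℝ] ℝ) (f : 𝓢(Sp d × Sp d, ℂ)) (z : Sp d × Sp d) :
    position (fun z => L z) f z = (L z : ℂ) * f z := by
  have h : (fun z => ((L z : ℝ) : ℂ)).HasTemperateGrowth :=
    (Complex.ofRealCLM.comp L).hasTemperateGrowth
  simp [position, SchwartzMap.smulLeftCLM_apply_apply h]

theorem momentum_apply (ħ : ℝ) (m : Sp d × Sp d) (f : 𝓢(Sp d × Sp d, ℂ)) (z : Sp d × Sp d) :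
    momentum ħ m f z = -(Complex.I * ħ) * fderiv ℝ f z m := by
  rw [← SchwartzMap.lineDerivOp_apply_eq_fderiv]
  rfl

theorem momentum_schwartzShear (ħ s : ℝ) (m : Sp d × Sp d) (f : 𝓢(Sp d × Sp d, ℂ))
    (z : Sp d × Sp d) :
    momentum ħ m (schwartzShear d s f) z = momentum ħ (shearEquiv d s m) f (shearEquiv d s z) := by
  rw [momentum_apply, momentum_apply]
  have : (schwartzShear d s f : Sp d × Sp d → ℂ) = f ∘ shearEquiv d s := rfl
  rw [this, ContinuousLinearEquiv.comp_right_fderiv]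
  rfl

/-- The shear maps positions and momenta to linear combinations of positions and momenta. -/
theorem conj_weylGenerators (ħ s : ℝ) (A : Module.End ℂ 𝓢(Sp d × Sp d, ℂ))
    (hA : A ∈ weylGenerators d ħ) :
    (schwartzShear d s).symm.conjAlgEquiv ℂ A ∈ Algebra.adjoin ℂ (weylGenerators d ħ) := by
  have q1 : ∀ j : Fin d, position (fun z : Sp d × Sp d => z.1 j) ∈ weylGenerators d ħ := fun j =>
    Or.inl (Or.inl (Or.inl ⟨j, rfl⟩))
  have q2 : ∀ j : Fin d, position (fun z : Sp d × Sp d => z.2 j) ∈ weylGenerators d ħ := fun j =>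
    Or.inl (Or.inl (Or.inr ⟨j, rfl⟩))
  have p1 : ∀ j : Fin d, momentum ħ ((dir j, 0) : Sp d × Sp d) ∈ weylGenerators d ħ := fun j =>
    Or.inl (Or.inr ⟨j, rfl⟩)
  have p2 : ∀ j : Fin d, momentum ħ ((0, dir j) : Sp d × Sp d) ∈ weylGenerators d ħ := fun j =>
    Or.inr ⟨j, rfl⟩
  have e1 : ∀ (j : Fin d) f z, position (fun z : Sp d × Sp d => z.1 j) f z = (z.1 j : ℂ) * f z :=
    fun j => position_apply ((EuclideanSpace.proj j).comp (ContinuousLinearMap.fst ℝ _ _))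
  have e2 : ∀ (j : Fin d) f z, position (fun z : Sp d × Sp d => z.2 j) f z = (z.2 j : ℂ) * f z :=
    fun j => position_apply ((EuclideanSpace.proj j).comp (ContinuousLinearMap.snd ℝ _ _))
  have hc : ∀ (A : Module.End ℂ 𝓢(Sp d × Sp d, ℂ)) f z,
      (schwartzShear d s).symm.conjAlgEquiv ℂ A f z =
        A (schwartzShear d s f) ((shearEquiv d s).symm z) := fun A f z => rfl
  rcases hA with ((⟨j, rfl⟩ | ⟨j, rfl⟩) | ⟨j, rfl⟩) | ⟨j, rfl⟩
  · have h : (schwartzShear d s).symm.conjAlgEquiv ℂ (position fun z : Sp d × Sp d => z.1 j) =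
        position fun z : Sp d × Sp d => z.1 j := by
      ext f z
      rw [hc, e1, e1, schwartzShear_apply, ContinuousLinearEquiv.apply_symm_apply,
        shearEquiv_symm_apply]
    exact h.symm ▸ Algebra.subset_adjoin (q1 j)
  · convert sub_mem (Algebra.subset_adjoin (R := ℂ) (q2 j))
      ((Algebra.adjoin ℂ (weylGenerators d ħ)).smul_mem
        (Algebra.subset_adjoin (R := ℂ) (q1 j)) (s : ℂ)) using 1
    ext f z
    rw [hc, e2, schwartzShear_apply, ContinuousLinearEquiv.apply_symm_apply,
      shearEquiv_symm_apply, LinearMap.sub_apply, LinearMap.smul_apply, sub_apply,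
      smul_apply, e1, e2]
    simp
    ring
  · convert add_mem (Algebra.subset_adjoin (R := ℂ) (p1 j))
      ((Algebra.adjoin ℂ (weylGenerators d ħ)).smul_mem
        (Algebra.subset_adjoin (R := ℂ) (p2 j)) (s : ℂ)) using 1
    ext f z
    have hm : ((dir j, s • dir j) : Sp d × Sp d) = (dir j, 0) + s • (0, dir j) := by simp
    rw [hc, momentum_schwartzShear, ContinuousLinearEquiv.apply_symm_apply,
      LinearMap.add_apply, LinearMap.smul_apply, add_apply,
      smul_apply, momentum_apply, momentum_apply, momentum_apply, shearEquiv_apply]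
    simp only [zero_add]
    rw [hm, map_add, map_smul, Complex.real_smul, smul_eq_mul]
    ring
  · have h : (schwartzShear d s).symm.conjAlgEquiv ℂ (momentum ħ ((0, dir j) : Sp d × Sp d)) =
        momentum ħ ((0, dir j) : Sp d × Sp d) := by
      ext f z
      rw [hc, momentum_schwartzShear, ContinuousLinearEquiv.apply_symm_apply, shearEquiv_apply,
        smul_zero, add_zero]
    exact h.symm ▸ Algebra.subset_adjoin (p2 j)

theorem conj_mem_adjoin (ħ s : ℝ) {A : Module.End ℂ 𝓢(Sp d × Sp d, ℂ)}
    (hA : A ∈ Algebra.adjoin ℂ (weylGenerators d ħ)) :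
    (schwartzShear d s).symm.conjAlgEquiv ℂ A ∈ Algebra.adjoin ℂ (weylGenerators d ħ) := by
  have h : Algebra.adjoin ℂ (weylGenerators d ħ) ≤ (Algebra.adjoin ℂ (weylGenerators d ħ)).comap
      ((schwartzShear d s).symm.conjAlgEquiv ℂ).toAlgHom :=
    Algebra.adjoin_le fun B hB => conj_weylGenerators ħ s B hB
  exact h hA

/-- The operators of an algebra transported along `ι` act as on the original space. -/
theorem conjAlgEquiv_ofInjective_apply {V H : Type*} [AddCommGroup V] [Module ℂ V]
    [AddCommGroup H] [Module ℂ H] (ι : V →ₗ[ℂ] H) (hι : Function.Injective ι)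
    (A : Module.End ℂ V) (f : V) (x : LinearMap.range ι) (hx : (x : H) = ι f) :
    (((LinearEquiv.ofInjective ι hι).conjAlgEquiv ℂ A x : LinearMap.range ι) : H) = ι (A f) := by
  have h : x = LinearEquiv.ofInjective ι hι f := Subtype.ext hx
  rw [h, LinearEquiv.conjAlgEquiv_apply_apply, LinearEquiv.symm_apply_apply,
    LinearEquiv.ofInjective_apply]

theorem isState_conj_shear (ħ s : ℝ)
    {ρ : Joint d (volume : Measure (Sp d)) →L[ℂ] Joint d (volume : Measure (Sp d))}
    (hρ : (weylAlgebra d ħ).IsState ρ) :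
    (weylAlgebra d ħ).IsState (conj (shear volume measurable_id' s) ρ) := by
  refine OStarAlgebra.IsState.conj_of_conj_mem ?_ ?_ hρ
  · rintro _ ⟨f, rfl⟩
    exact ⟨schwartzShear d s f, schwartzIncl_schwartzShear s f⟩
  · rintro _ ⟨A, hA, rfl⟩
    refine ⟨_, ⟨_, conj_mem_adjoin ħ s hA, rfl⟩, ?_⟩
    rintro ⟨_, f, rfl⟩ y hy
    rw [← schwartzIncl_schwartzShear] at hy
    have h1 := conjAlgEquiv_ofInjective_apply (schwartzIncl d) (schwartzIncl_injective d) A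
      (schwartzShear d s f) y hy
    have h2 := conjAlgEquiv_ofInjective_apply (schwartzIncl d) (schwartzIncl_injective d)
      ((schwartzShear d s).symm.conjAlgEquiv ℂ A) f ⟨schwartzIncl d f, f, rfl⟩ rfl
    refine h1.trans ?_
    refine Eq.trans ?_ (congrArg _ h2.symm)
    rw [← schwartzIncl_schwartzShear]
    congr 1
    exact ((schwartzShear d s).apply_symm_apply _).symm

end Weyl

end QRNumber

end

theorem mainTheorem6 {d : ℕ} {X : Type*} [MeasurableSpace X] (μ : Measure X) [SigmaFinite μ]
    (q : X → QRNumber.Sp d) (hq : Measurable q) (γ ħ σ : ℝ) (hħ : 0 < ħ)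
    (hσ : σ = 1 ∨ σ = -1) :
    -- the Hamiltonian generates a unique unitary group
    (∃! G : QRNumber.UnitaryGroup (QRNumber.Joint d μ),
      QRNumber.IsGenerated μ q γ ħ σ G) ∧
    (∀ G : QRNumber.UnitaryGroup (QRNumber.Joint d μ), QRNumber.IsGenerated μ q γ ħ σ G →
      -- evolution of an arbitrary joint wave function
      (∀ (Φ : QRNumber.Joint d μ) (t : ℝ), ∀ᵐ z ∂(μ.prod (volume : Measure (QRNumber.Sp d))),
        (G.U t Φ) z = Φ (z.1, z.2 + (σ * γ * t) • q z.1)) ∧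
      -- evolution of the conditions centred on an arbitrary smooth joint wave function
      (∀ 𝒜 : QRNumber.OStarAlgebra (QRNumber.Joint d μ), QRNumber.ActsOnStates G 𝒜 →
        ∀ (t₁ t₂ δ : ℝ), 0 < δ → ∀ Ψ₁ ∈ 𝒜.domain, ‖Ψ₁‖ = 1 →
          QRNumber.EvolvesTo G t₁ t₂
            (QRNumber.nu 𝒜 (QRNumber.proj Ψ₁) δ)
            (QRNumber.nu 𝒜 (QRNumber.proj (G.U (t₂ - t₁) Ψ₁)) δ) ∧
          ∀ j, ∀ Q ∈ 𝒜.alg, QRNumber.IsMeasurand q j 𝒜 Q →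
            QRNumber.EvolvesTo G t₁ t₂
              (QRNumber.subNu 𝒜 (QRNumber.proj Ψ₁) Q δ)
              (QRNumber.subNu 𝒜 (QRNumber.proj (G.U (t₂ - t₁) Ψ₁)) Q δ)) ∧
      -- measurement of a superposition of two eigenvectors of the measurand
      (∀ (t₁ t₂ : ℝ) (ψp ψm : Lp ℂ 2 μ) (φ : Lp ℂ 2 (volume : Measure (QRNumber.Sp d)))
        (lp lm : QRNumber.Sp d) (α β : ℂ),
        QRNumber.IsEigen q lp ψp → QRNumber.IsEigen q lm ψm →
        ‖ψp‖ = 1 → ‖ψm‖ = 1 → ⟪ψp, ψm⟫_ℂ = 0 → ‖φ‖ = 1 → ‖α‖ ^ 2 + ‖β‖ ^ 2 = 1 →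
        ∃ φp φm : Lp ℂ 2 (volume : Measure (QRNumber.Sp d)), ‖φp‖ = 1 ∧ ‖φm‖ = 1 ∧
          QRNumber.IsPointer q (σ * γ * (t₂ - t₁)) ψp φ φp ∧
          QRNumber.IsPointer q (σ * γ * (t₂ - t₁)) ψm φ φm ∧
          (∀ᵐ y, φp y = φ (y + (σ * γ * (t₂ - t₁)) • lp)) ∧
          (∀ᵐ y, φm y = φ (y + (σ * γ * (t₂ - t₁)) • lm)) ∧
          G.U (t₂ - t₁) (QRNumber.tensor (α • ψp + β • ψm) φ) =
            α • QRNumber.tensor ψp φp + β • QRNumber.tensor ψm φm ∧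
          (α ≠ 0 → β ≠ 0 → γ ≠ 0 → t₁ ≠ t₂ → lp ≠ lm →
            QRNumber.IsEntangled μ
              (α • QRNumber.tensor ψp φp + β • QRNumber.tensor ψm φm)) ∧
          ∀ 𝒜 : QRNumber.OStarAlgebra (QRNumber.Joint d μ), QRNumber.ActsOnStates G 𝒜 →
            QRNumber.tensor (α • ψp + β • ψm) φ ∈ 𝒜.domain → ∀ δ : ℝ, 0 < δ →
            QRNumber.EvolvesTo G t₁ t₂
              (QRNumber.nu 𝒜 (QRNumber.proj (QRNumber.tensor (α • ψp + β • ψm) φ)) δ)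
              (QRNumber.nu 𝒜 (QRNumber.proj
                (α • QRNumber.tensor ψp φp + β • QRNumber.tensor ψm φm)) δ) ∧
            ∀ j, ∀ Q ∈ 𝒜.alg, QRNumber.IsMeasurand q j 𝒜 Q →
              QRNumber.EvolvesTo G t₁ t₂
                (QRNumber.subNu 𝒜
                  (QRNumber.proj (QRNumber.tensor (α • ψp + β • ψm) φ)) Q δ)
                (QRNumber.subNu 𝒜 (QRNumber.proj
                  (α • QRNumber.tensor ψp φp + β • QRNumber.tensor ψm φm)) Q δ)) ∧
      -- the same wave functions for approximate eigenvectors of the measurand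
      (∀ (t₁ t₂ : ℝ) (φ : Lp ℂ 2 (volume : Measure (QRNumber.Sp d))), ‖φ‖ = 1 →
        ∀ η : ℝ, 0 < η → ∃ r : ℝ, 0 < r ∧
        ∀ (ψp ψm : Lp ℂ 2 μ) (lp lm : QRNumber.Sp d) (α β : ℂ),
        (∀ᵐ x ∂μ, ψp x ≠ 0 → ‖q x - lp‖ ≤ r) → (∀ᵐ x ∂μ, ψm x ≠ 0 → ‖q x - lm‖ ≤ r) →
        ‖ψp‖ = 1 → ‖ψm‖ = 1 → ⟪ψp, ψm⟫_ℂ = 0 → ‖α‖ ^ 2 + ‖β‖ ^ 2 = 1 →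
        ∃ φp φm : Lp ℂ 2 (volume : Measure (QRNumber.Sp d)),
          QRNumber.IsPointer q (σ * γ * (t₂ - t₁)) ψp φ φp ∧
          QRNumber.IsPointer q (σ * γ * (t₂ - t₁)) ψm φ φm ∧
          ‖G.U (t₂ - t₁) (QRNumber.tensor (α • ψp + β • ψm) φ) -
            (α • QRNumber.tensor ψp φp + β • QRNumber.tensor ψm φm)‖ ≤ η)) ∧
    -- for two particles in the Schrödinger representation the group acts on the smooth states
    (∀ G : QRNumber.UnitaryGroup (QRNumber.Joint d (volume : Measure (QRNumber.Sp d))),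
      QRNumber.IsGenerated volume (fun x => x) γ ħ σ G →
        QRNumber.ActsOnStates G (QRNumber.weylAlgebra d ħ)) := by
  have hħ' : ħ ≠ 0 := hħ.ne'
  refine ⟨QRNumber.existsUnique_isGenerated hq γ σ hħ', fun G hG => ?_, fun G hG t ρ hρ => ?_⟩
  swap
  · have e : G.U t = QRNumber.shear volume measurable_id' (σ * γ * t) :=
      LinearIsometryEquiv.ext fun Φ => hG.apply_eq measurable_id' hħ' t Φ
    rw [e]
    exact QRNumber.isState_conj_shear ħ _ hρ
  have hU : ∀ t Φ, G.U t Φ = QRNumber.shear μ hq (σ * γ * t) Φ := hG.apply_eq hq hħ'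
  refine ⟨fun Φ t => ?_, fun 𝒜 hA t₁ t₂ δ _ Ψ hΨ hn =>
    QRNumber.evolvesTo_of_shear hq hA (hU _) δ hΨ hn rfl, ?_, fun t₁ t₂ φ _ η hη => ?_⟩
  · rw [hU]
    exact QRNumber.shear_ae_eq hq _ Φ
  · intro t₁ t₂ ψp ψm φ lp lm α β hep hem hp hm hpm hφ hαβ
    have hevol := (hU (t₂ - t₁) _).trans
      (QRNumber.shear_superposition hq (σ * γ * (t₂ - t₁)) ψp ψm φ α β)
    rw [QRNumber.shear_tensor_of_eq hq _ hep.ae_eq,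
      QRNumber.shear_tensor_of_eq hq _ hem.ae_eq] at hevol
    refine ⟨QRNumber.translate ((σ * γ * (t₂ - t₁)) • lp) φ,
      QRNumber.translate ((σ * γ * (t₂ - t₁)) • lm) φ,
      ((QRNumber.translate _).norm_map φ).trans hφ, ((QRNumber.translate _).norm_map φ).trans hφ,
      QRNumber.isPointer_translate hq _ hep hp φ, QRNumber.isPointer_translate hq _ hem hm φ,
      QRNumber.translate_ae_eq _ φ, QRNumber.translate_ae_eq _ φ, hevol,
      fun hα hβ hγ ht hl => ?_, fun 𝒜 hA hD δ _ => ?_⟩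
    · have hσ0 : σ ≠ 0 := by rcases hσ with rfl | rfl <;> norm_num
      have hs0 : σ * γ * (t₂ - t₁) ≠ 0 := mul_ne_zero (mul_ne_zero hσ0 hγ) (sub_ne_zero.2 ht.symm)
      refine QRNumber.isEntangled_of_ne hp hm hpm (norm_ne_zero_iff.1 ?_)
        (fun h => hl (smul_right_injective _ hs0 h)) hα hβ
      rw [hφ]
      exact one_ne_zero
    · refine QRNumber.evolvesTo_of_shear hq hA (hU _) δ hD ?_ hevol
      rw [QRNumber.norm_tensor, QRNumber.norm_superposition hp hm hpm hαβ, hφ, one_mul]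
  · obtain ⟨r, hr, h⟩ := QRNumber.exists_pointer_near (μ := μ) hq (σ * γ * (t₂ - t₁)) φ hη
    refine ⟨r, hr, fun ψp ψm lp lm α β hqp hqm hp hm _ hαβ => ?_⟩
    rw [hU]
    exact h ψp ψm lp lm α β hqp hqm hp hm hαβ
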